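/- **Setting.** Fix countably infinite, mutually disjoint sets of concept names $A$, role names $P$ and individual names $a$. Basic roles are $Q ::= P\mid P^-$, basic concepts are $B ::= A\mid\exists Q$, and general roles and concepts are $R ::= Q\mid\neg Q$, $C ::= B\mid\neg B$. A fuzzy DL-Lite$_R$ TBox is a finite set of axioms $\langle B\sqsubseteq C,d\rangle$, $\langle Q\sqsubseteq R,d\rangle$; an ABox is a finite set of assertions $\langle B(a),d\rangle$, $\langle P(a,b),d\rangle$; an ontology is a pair $(\mathcal T,\mathcal A)$ of a TBox and an ABox. All degrees $d$ written in axioms, assertions and queries are rational numbers in $[0,1]$. An interpretation $\mathcal I$ has a non-empty domain $\Delta$ and maps individual names to elements of $\Delta$, concept names to functions $\Delta\to[0,1]$ and role names to functions $\Delta\times\Delta\to[0,1]$ (real values), extended by $(P^-)^{\mathcal I}(\delta,\eta)=P^{\mathcal I}(\eta,\delta)$, $(\exists Q)^{\mathcal I}(\delta)=\sup_{\eta\in\Delta}Q^{\mathcal I}(\delta,\eta)$, $(\neg X)^{\mathcal I}=(X^{\mathcal I}\Rightarrow 0)$, where $\Rightarrow$ is the Gödel residuum: $x\Rightarrow y$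 is $1$ if $x\le y$ and $y$ otherwise. It satisfies $\langle X\sqsubseteq Y,d\rangle$ if $(X^{\mathcal I}\Rightarrow Y^{\mathcal I})\ge d$ at all elements (pairs of elements), $\langle B(a),d\rangle$ if $B^{\mathcal I}(a^{\mathcal I})\ge d$, and $\langle P(a,b),d\rangle$ if $P^{\mathcal I}(a^{\mathcal I},b^{\mathcal I})\ge d$; it is a model of an ontology if it satisfies all its axioms and assertions. An ontology is consistent if it has a model. A threshold query $q(\mathbf x)=\exists\mathbf y.\varphi(\mathbf x,\mathbf y)$ is given by a finite conjunction $\varphi$ of threshold atoms $B(t)\ge d$ and $P(t_1,t_2)\ge d$, whose terms are variables from $\mathbf x,\mathbf y$ or individual names. A tuple $\mathbf a$ of individual names is an answer in $\mathcal I$ if, with $\mathbf x$ sent to $\mathbf a^{\mathcal I}$, the variables $\mathbf y$ can be mapped to elements of $\Delta$ such that every atom has degree at least its threshold; it is a certain answer over $(\mathcal T,\mathcal A)$ if it is an answer in every model of $(\mathcal T,\mathcal A)$. **Theorem.** Under the Gödel semantics, answering threshold queries over consistent fuzzy DL-Lite$_R$ ontologies is in $\mathrm{AC}^0$ in data complexity.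 That is, for every fixed TBox $\mathcal T$ and every fixed threshold query $q(\mathbf x)$, the following problem is in $\mathrm{AC}^0$: given (a word encoding) an ABox $\mathcal A$ such that $(\mathcal T,\mathcal A)$ is consistent and a tuple $\mathbf a$ of individual names of the length of $\mathbf x$, decide whether $\mathbf a$ is a certain answer to $q$ over $(\mathcal T,\mathcal A)$. Here the input lists $\mathbf a$ and the assertions of $\mathcal A$, with names given as natural numbers in binary and degrees given by their numerators and denominators in binary, over a finite alphabet. $\mathrm{AC}^0$ is the class of languages decided by first-order uniform families of unbounded fan-in Boolean circuits of constant depth and polynomial size (the circuit for words of length $n$ is described by fixed first-order formulas over $\{0,\dots,n\}$ with $\le,+,\times$); that the problem is in $\mathrm{AC}^0$ means that some language in $\mathrm{AC}^0$ gives the correct answer on the encoding of every input for which $(\mathcal T,\mathcal A)$ is consistent. -/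

import Mathlib

namespace FuzzyDL

/-! ## Syntax of fuzzy DL-Lite_R

Concept, role and individual names are three countably infinite, mutually disjoint supplies of names
(each a copy of `ℕ`; different kinds of names never occur in the same syntactic position). -/

abbrev ConceptName := ℕ
abbrev RoleName := ℕ
abbrev IndName := ℕ

/-- Degrees written in axioms, assertions and queries: rational numbers in `[0,1]`,
so that an ABox is a finite object that can be given as an input word. -/
abbrev Degree := Set.Icc (0 : ℚ) 1

/-- Basic roles `Q ::= P | P⁻`. -/
inductive BasicRole where
  | name (P : RoleName)
  | inv (P : RoleName)

/-- Basic concepts `B ::= A | ∃Q`. -/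
inductive BasicConcept where
  | name (A : ConceptName)
  | ex (Q : BasicRole)

/-- General concepts `C ::= B | ¬B`. -/
inductive GeneralConcept where
  | pos (B : BasicConcept)
  | neg (B : BasicConcept)

/-- General roles `R ::= Q | ¬Q`. -/
inductive GeneralRole where
  | pos (Q : BasicRole)
  | neg (Q : BasicRole)

/-- TBox axioms `⟨B ⊑ C, d⟩` and `⟨Q ⊑ R, d⟩`. -/
inductive TBoxAxiom where
  | concept (B : BasicConcept) (C : GeneralConcept) (d : Degree)
  | role (Q : BasicRole) (R : GeneralRole) (d : Degree)

/-- ABox assertions `⟨B(a), d⟩` and `⟨P(a,b), d⟩`. -/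
inductive Assertion where
  | concept (B : BasicConcept) (a : IndName) (d : Degree)
  | role (P : RoleName) (a b : IndName) (d : Degree)

/-- A TBox is a finite set of axioms, presented by listing its elements. -/
abbrev TBox := List TBoxAxiom

/-- An ABox is a finite set of assertions, presented by listing its elements. -/
abbrev ABox := List Assertion

structure Ontology where
  tbox : TBox
  abox : ABox

/-! ## Gödel semantics -/

/-- The residuum of the Gödel t-norm `min`. -/
noncomputable def godelImp (d e : ℝ) : ℝ := if d ≤ e then 1 else e

/-- The Gödel negation `d ⇒ 0`. -/
noncomputable def godelNeg (d : ℝ) : ℝ := godelImp d 0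

/-- A fuzzy interpretation with domain `Δ` (which is non-empty because names are interpreted). -/
structure Interpretation (Δ : Type) where
  ind : IndName → Δ
  concept : ConceptName → Δ → unitInterval
  role : RoleName → Δ → Δ → unitInterval

namespace Interpretation

variable {Δ : Type} (I : Interpretation Δ)

def basicRole : BasicRole → Δ → Δ → ℝ
  | .name P, x, y => I.role P x y
  | .inv P, x, y => I.role P y x

noncomputable def basicConcept : BasicConcept → Δ → ℝ
  | .name A, x => I.concept A x
  | .ex Q, x => ⨆ y, I.basicRole Q x y

noncomputable def generalConcept : GeneralConcept → Δ → ℝ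
  | .pos B, x => I.basicConcept B x
  | .neg B, x => godelNeg (I.basicConcept B x)

noncomputable def generalRole : GeneralRole → Δ → Δ → ℝ
  | .pos Q, x, y => I.basicRole Q x y
  | .neg Q, x, y => godelNeg (I.basicRole Q x y)

def SatAxiom : TBoxAxiom → Prop
  | .concept B C d => ∀ x, ((d : ℚ) : ℝ) ≤ godelImp (I.basicConcept B x) (I.generalConcept C x)
  | .role Q R d => ∀ x y, ((d : ℚ) : ℝ) ≤ godelImp (I.basicRole Q x y) (I.generalRole R x y)

def SatAssertion : Assertion → Prop
  | .concept B a d => ((d : ℚ) : ℝ) ≤ I.basicConcept B (I.ind a)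
  | .role P a b d => ((d : ℚ) : ℝ) ≤ I.role P (I.ind a) (I.ind b)

def IsModel (O : Ontology) : Prop :=
  (∀ α ∈ O.tbox, I.SatAxiom α) ∧ ∀ α ∈ O.abox, I.SatAssertion α

end Interpretation

def Ontology.Consistent (O : Ontology) : Prop :=
  ∃ (Δ : Type) (I : Interpretation Δ), I.IsModel O

/-! ## Threshold queries -/

/-- Terms over `m` answer variables, `k` existential variables and the individual names. -/
inductive Term (m k : ℕ) where
  | answerVar (i : Fin m)
  | exVar (j : Fin k)
  | ind (a : IndName)

/-- Threshold atoms `B(t) ≥ d` and `P(t₁,t₂) ≥ d`. -/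
inductive ThresholdAtom (m k : ℕ) where
  | concept (B : BasicConcept) (t : Term m k) (d : Degree)
  | role (P : RoleName) (t₁ t₂ : Term m k) (d : Degree)

/-- A threshold query with `m` answer variables: existentially quantified variables and
a conjunction of threshold atoms. -/
structure ThresholdQuery (m : ℕ) where
  numEx : ℕ
  atoms : List (ThresholdAtom m numEx)

variable {Δ : Type} {m k : ℕ}

/-- The value of a term under the match that sends the answer variables to the interpretations of
the individuals `a` and the existential variables to `π`. -/
def Term.value (I : Interpretation Δ) (a : Fin m → IndName) (π : Fin k → Δ) : Term m k → Δ
  | .answerVar i => I.ind (a i)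
  | .exVar j => π j
  | .ind c => I.ind c

def ThresholdAtom.Sat (I : Interpretation Δ) (a : Fin m → IndName) (π : Fin k → Δ) :
    ThresholdAtom m k → Prop
  | .concept B t d => ((d : ℚ) : ℝ) ≤ I.basicConcept B (t.value I a π)
  | .role P t₁ t₂ d => ((d : ℚ) : ℝ) ≤ I.role P (t₁.value I a π) (t₂.value I a π)

/-- `a` is an answer to `q` with respect to the interpretation `I`. -/
def ThresholdQuery.IsAnswer (q : ThresholdQuery m) (I : Interpretation Δ)
    (a : Fin m → IndName) : Prop :=
  ∃ π : Fin q.numEx → Δ, ∀ γ ∈ q.atoms, γ.Sat I a π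

/-- `a` is a certain answer to `q` over the ontology `O`. -/
def ThresholdQuery.IsCertainAnswer (q : ThresholdQuery m) (O : Ontology)
    (a : Fin m → IndName) : Prop :=
  ∀ (Δ : Type) (I : Interpretation Δ), I.IsModel O → q.IsAnswer I a

/-! ## Encoding of the data: an ABox together with a candidate answer -/

inductive Letter where
  | zero | one | sep | concept | ex | exInv | role | answer
  deriving DecidableEq

instance : Finite Letter :=
  Finite.of_surjective
    (![Letter.zero, .one, .sep, .concept, .ex, .exInv, .role, .answer] : Fin 8 → Letter)
    (by rintro (_ | _ | _ | _ | _ | _ | _ | _) <;>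
      first | exact ⟨0, rfl⟩ | exact ⟨1, rfl⟩ | exact ⟨2, rfl⟩ | exact ⟨3, rfl⟩ | exact ⟨4, rfl⟩ |
        exact ⟨5, rfl⟩ | exact ⟨6, rfl⟩ | exact ⟨7, rfl⟩)

/-- Binary notation of a natural number (least significant bit first), closed by a separator. -/
def encodeNat (n : ℕ) : List Letter :=
  (n.bits.map fun b => if b then Letter.one else Letter.zero) ++ [Letter.sep]

/-- A degree is written as numerator and denominator (in lowest terms), both in binary. -/
def encodeDegree (d : Degree) : List Letter :=
  encodeNat (d : ℚ).num.toNat ++ encodeNat (d : ℚ).den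

def encodeBasicConcept : BasicConcept → List Letter
  | .name A => Letter.concept :: encodeNat A
  | .ex (.name P) => Letter.ex :: encodeNat P
  | .ex (.inv P) => Letter.exInv :: encodeNat P

def encodeAssertion : Assertion → List Letter
  | .concept B a d => encodeBasicConcept B ++ encodeNat a ++ encodeDegree d
  | .role P a b d => Letter.role :: (encodeNat P ++ encodeNat a ++ encodeNat b ++ encodeDegree d)

def encodeAnswer (a : Fin m → IndName) : List Letter :=
  (List.ofFn a).flatMap fun c => Letter.answer :: encodeNat c

def encodeData (x : ABox × (Fin m → IndName)) : List Letter :=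
  encodeAnswer x.2 ++ x.1.flatMap encodeAssertion

end FuzzyDL

/-! ## Uniform AC⁰ -/

namespace AC0

/-- Gates of a circuit reading words of length `n` over the alphabet `Γ`.
The gate `input i s` asks whether the letter at position `i` is `s`. -/
inductive GateKind (Γ : Type) (n : ℕ) where
  | input (i : Fin n) (s : Γ)
  | and
  | or
  | not

/-- Boolean circuits with unbounded fan-in. `wire h g` says that gate `h` feeds into gate `g`. -/
structure Circuit (Γ : Type) (n : ℕ) where
  Gate : Type
  finite : Finite Gate
  kind : Gate → GateKind Γ n
  wire : Gate → Gate → Prop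
  acyclic : WellFounded wire
  not_fanIn : ∀ g, kind g = GateKind.not → ∃! h, wire h g
  output : Gate

namespace Circuit

variable {Γ : Type} {n : ℕ} (C : Circuit Γ n)

noncomputable def size : ℕ := Nat.card C.Gate

/-- Every directed path has at most `d` wires. -/
def DepthLE (d : ℕ) : Prop :=
  ∃ rank : C.Gate → ℕ, (∀ g, rank g ≤ d) ∧ ∀ h g, C.wire h g → rank h < rank g

/-- The value at `g` of a gate assignment `v` is the one computed by `g` on the word `w`. -/
def CorrectAt (w : Fin n → Γ) (v : C.Gate → Prop) (g : C.Gate) : Prop :=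
  match C.kind g with
  | .input i s => v g ↔ w i = s
  | .and => v g ↔ ∀ h, C.wire h g → v h
  | .or => v g ↔ ∃ h, C.wire h g ∧ v h
  | .not => v g ↔ ∀ h, C.wire h g → ¬ v h

def IsEvaluation (w : Fin n → Γ) (v : C.Gate → Prop) : Prop := ∀ g, C.CorrectAt w v g

/-- The output gate has value true on the word `w`. -/
def Accepts (w : Fin n → Γ) : Prop := ∃ v, C.IsEvaluation w v ∧ v C.output

/-- The evaluation of a circuit on a word exists and is unique. -/
theorem existsUnique_isEvaluation (w : Fin n → Γ) : ∃! v, C.IsEvaluation w v := by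
  classical
  let F : ∀ g, (∀ h, C.wire h g → Prop) → Prop := fun g ih =>
    match C.kind g with
    | .input i s => w i = s
    | .and => ∀ h, ∀ hw : C.wire h g, ih h hw
    | .or => ∃ h, ∃ hw : C.wire h g, ih h hw
    | .not => ∀ h, ∀ hw : C.wire h g, ¬ ih h hw
  refine ⟨fun g => C.acyclic.fix F g, ?_, ?_⟩
  · intro g
    unfold CorrectAt
    have h := C.acyclic.fix_eq F g
    cases hk : C.kind g <;> simp only [F, hk] at h ⊢ <;> (rw [h]; try simp)
  · intro v hv
    funext g
    induction g using C.acyclic.induction with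
    | _ g ih =>
      have h := C.acyclic.fix_eq F g
      have hg := hv g
      unfold CorrectAt at hg
      cases hk : C.kind g <;> simp only [F, hk] at h hg <;> rw [h] <;> refine propext (hg.trans ?_)
      · rfl
      · exact forall_congr' fun x => forall_congr' fun hx => by rw [ih x hx]
      · exact ⟨fun ⟨x, hx, hv⟩ => ⟨x, hx, ih x hx ▸ hv⟩,
          fun ⟨x, hx, hv⟩ => ⟨x, hx, (ih x hx).symm ▸ hv⟩⟩
      · exact forall_congr' fun x => forall_congr' fun hx => by rw [ih x hx]

end Circuit

/-! Uniformity: the circuit for length `n` is described by fixed first-order formulas over the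
numbers `0, …, n` with order, addition and multiplication. -/

inductive ArithRel : ℕ → Type where
  | le : ArithRel 2
  | add : ArithRel 3
  | mul : ArithRel 3

def arith : FirstOrder.Language.{0, 0} := ⟨fun _ => Empty, ArithRel⟩

def ArithRel.Holds {n : ℕ} : ∀ {k : ℕ}, ArithRel k → (Fin k → Fin (n + 1)) → Prop
  | _, .le, x => (x 0 : ℕ) ≤ x 1
  | _, .add, x => (x 0 : ℕ) + x 1 = x 2
  | _, .mul, x => (x 0 : ℕ) * x 1 = x 2

instance arithStructure (n : ℕ) : arith.Structure (Fin (n + 1)) where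
  funMap f := Empty.elim f
  RelMap r x := ArithRel.Holds r x

/-- First-order description of a circuit family. Gates are named by one of finitely many tags
together with a tuple of numbers of fixed length. -/
structure Description (Γ : Type) where
  tags : ℕ
  width : ℕ
  gate : Fin tags → arith.Formula (Fin width)
  input : Fin tags → Γ → arith.Formula (Fin width ⊕ Fin 1)
  and : Fin tags → arith.Formula (Fin width)
  or : Fin tags → arith.Formula (Fin width)
  not : Fin tags → arith.Formula (Fin width)
  wire : Fin tags → Fin tags → arith.Formula (Fin width ⊕ Fin width)
  output : Fin tags → arith.Formula (Fin width)

/-- Up to naming its gates, `C` is the circuit for words of length `n` described by `D`. -/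
def Description.Describes {Γ : Type} (D : Description Γ) {n : ℕ} (C : Circuit Γ n) : Prop :=
  ∃ (tag : C.Gate → Fin D.tags) (num : C.Gate → Fin D.width → Fin (n + 1)),
    (Function.Injective fun g => (tag g, num g)) ∧
    (∀ t x, (D.gate t).Realize x ↔ ∃ g, tag g = t ∧ num g = x) ∧
    (∀ g i s, C.kind g = .input i s ↔
      (D.input (tag g) s).Realize (Sum.elim (num g) fun _ => i.castSucc)) ∧
    (∀ g, C.kind g = .and ↔ (D.and (tag g)).Realize (num g)) ∧
    (∀ g, C.kind g = .or ↔ (D.or (tag g)).Realize (num g)) ∧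
    (∀ g, C.kind g = .not ↔ (D.not (tag g)).Realize (num g)) ∧
    (∀ h g, C.wire h g ↔ (D.wire (tag h) (tag g)).Realize (Sum.elim (num h) (num g))) ∧
    ∀ g, g = C.output ↔ (D.output (tag g)).Realize (num g)

/-- A language is in (uniform) AC⁰ if it is decided by a uniform family of Boolean circuits of
constant depth, polynomial size and unbounded fan-in. -/
def InAC0 {Γ : Type} [Finite Γ] (L : Set (List Γ)) : Prop :=
  ∃ C : ∀ n, Circuit Γ n,
    (∃ d : ℕ, ∀ n, (C n).DepthLE d) ∧
    (∃ p : Polynomial ℕ, ∀ n, (C n).size ≤ p.eval n) ∧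
    (∃ D : Description Γ, ∀ n, D.Describes (C n)) ∧
    ∀ w : List Γ, (C w.length).Accepts w.get ↔ w ∈ L

/-- A decision problem, whose instances `x` satisfying a promise are given by their encodings, is
in AC⁰ if some language in AC⁰ answers all promised instances correctly. -/
def PromiseInAC0 {ι Γ : Type} [Finite Γ] (encode : ι → List Γ) (promise answer : ι → Prop) : Prop :=
  ∃ L : Set (List Γ), InAC0 L ∧ ∀ x, promise x → (encode x ∈ L ↔ answer x)

end AC0

/-!
Answering a threshold query is first-order expressible over the words that encode the data, with
order and addition on positions, and a first-order sentence is evaluated by a uniform family of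
circuits with one gate for each subformula and each assignment of numbers to its variables
(`AC0.WordFormula.inAC0`).

The expressibility does not go through a rewriting of the query. It rests on two properties of
certain answers.

* *Locality* (`FuzzyDL.exists_support`). All axioms have a single concept or role on the left, so
  each degree in the canonical model is derived from a single assertion. A match of the query in the
  canonical model therefore uses at most one assertion for each atom: if `a` is a certain answer
  over a consistent ontology, it is one over a part of the ABox whose size is bounded by the query.
  Suprema need not be attained in models, so an anonymous successor in the canonical model cannot be
  given the full degree of the existential concept that demands it. Instead there are infinitely
  many successors whose degrees approach it from below, which makes the canonical model map
  homomorphically to every model. Consistency is needed only for the negative axioms, which the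
  canonical model inherits from any model along this homomorphism.

* *Invariance* (`FuzzyDL.Instance.Refines.isCertainAnswer`). For an ABox of bounded size, being a
  certain answer depends only on the predicates, on which of the individuals are equal to each other
  or to an individual of the query, and on how the degrees compare with `0`, `1` and the thresholds
  of the query. The degrees of the assertions need not be compared with each other, which would
  amount to multiplying binary numbers: a continuous monotone map of the unit interval that fixes
  the thresholds, and only raises degrees, turns models into models, and it can move the degree of
  an assertion arbitrarily close to the next threshold.

So there are finitely many types of small parts of an ABox, and the answer is the disjunction, over
the types that make the tuple a certain answer, of the sentence saying that assertions of
this type occur in the word. Such a sentence compares names, which are blocks of letters, and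
compares a degree with a fixed rational number, which amounts to comparing fixed multiples of its
numerator and of its denominator. This is first-order by carry lookahead (`AC0.add_carry_iff`);
the multiples may have more bits than there are positions in the word, and `AC0.FONum` accounts for
the excess.
-/

/-! ### First-order formulas over words and their circuits -/

namespace AC0

/-- First-order formulas over a word: variables range over the numbers `0, …, n`, where `n` is the
length of the word, and are de Bruijn indices. `letter i s` says that the letter at the position
given by the variable `i` is `s`; it is false at the value `n`, which is not a position. -/
inductive WordFormula (Γ : Type) where
  | le (i j : ℕ)
  | add (i j l : ℕ)
  | letter (i : ℕ) (s : Γ)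
  | not (φ : WordFormula Γ)
  | and (φ ψ : WordFormula Γ)
  | ex (φ : WordFormula Γ)

/-- The environment `v` extended by the value `y` for the innermost variable. -/
def push (y : ℕ) (v : ℕ → ℕ) : ℕ → ℕ
  | 0 => y
  | i + 1 => v i

@[simp] theorem push_zero (y : ℕ) (v : ℕ → ℕ) : push y v 0 = y := rfl

@[simp] theorem push_succ (y : ℕ) (v : ℕ → ℕ) (i : ℕ) : push y v (i + 1) = v i := rfl

namespace WordFormula

variable {Γ : Type}

/-- Satisfaction in the word `w`; an atom `letter i s` is false at values outside the word. -/
def Realize (w : List Γ) : WordFormula Γ → (ℕ → ℕ) → Prop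
  | le i j, v => v i ≤ v j
  | add i j l, v => v i + v j = v l
  | letter i s, v => w[v i]? = some s
  | not φ, v => ¬ φ.Realize w v
  | and φ ψ, v => φ.Realize w v ∧ ψ.Realize w v
  | ex φ, v => ∃ y ≤ w.length, φ.Realize w (push y v)

/-- A strict upper bound for the indices of all variables, free or bound, of a formula. -/
def bound : WordFormula Γ → ℕ
  | le i j => max i j + 1
  | add i j l => max (max i j) l + 1
  | letter i _ => i + 1
  | not φ => φ.bound
  | and φ ψ => max φ.bound ψ.bound
  | ex φ => φ.bound

def depth : WordFormula Γ → ℕ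
  | not φ => φ.depth + 1
  | and φ ψ => max φ.depth ψ.depth + 1
  | ex φ => φ.depth + 1
  | _ => 0

def subs : WordFormula Γ → List (WordFormula Γ)
  | not φ => not φ :: φ.subs
  | and φ ψ => and φ ψ :: (φ.subs ++ ψ.subs)
  | ex φ => ex φ :: φ.subs
  | φ => [φ]

theorem self_mem_subs (φ : WordFormula Γ) : φ ∈ φ.subs := by
  cases φ <;> simp [subs]

theorem subs_subset {φ ψ : WordFormula Γ} (h : ψ ∈ φ.subs) : ψ.subs ⊆ φ.subs := by
  induction φ with
  | le | add | letter => simp only [subs, List.mem_singleton] at h; subst h; simp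
  | not φ ih | ex φ ih =>
    simp only [subs, List.mem_cons] at h
    rcases h with rfl | h
    · exact List.Subset.refl _
    · exact fun _ hx => List.mem_cons_of_mem _ (ih h hx)
  | and φ χ ih₁ ih₂ =>
    simp only [subs, List.mem_cons, List.mem_append] at h
    rcases h with rfl | h | h
    · exact List.Subset.refl _
    · exact fun _ hx => List.mem_cons_of_mem _ (List.mem_append_left _ (ih₁ h hx))
    · exact fun _ hx => List.mem_cons_of_mem _ (List.mem_append_right _ (ih₂ h hx))

theorem bound_le_of_mem_subs {φ ψ : WordFormula Γ} (h : ψ ∈ φ.subs) : ψ.bound ≤ φ.bound := by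
  induction φ with
  | le | add | letter => simp only [subs, List.mem_singleton] at h; subst h; rfl
  | not φ ih | ex φ ih =>
    simp only [subs, List.mem_cons] at h
    rcases h with rfl | h
    · rfl
    · exact ih h
  | and φ χ ih₁ ih₂ =>
    simp only [subs, List.mem_cons, List.mem_append] at h
    rcases h with rfl | h | h
    · rfl
    · exact (ih₁ h).trans (le_max_left _ _)
    · exact (ih₂ h).trans (le_max_right _ _)

theorem depth_le_of_mem_subs {φ ψ : WordFormula Γ} (h : ψ ∈ φ.subs) : ψ.depth ≤ φ.depth := by
  induction φ with
  | le | add | letter => simp only [subs, List.mem_singleton] at h; subst h; rfl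
  | not φ ih | ex φ ih =>
    simp only [subs, List.mem_cons] at h
    rcases h with rfl | h
    · rfl
    · exact (ih h).trans (Nat.le_succ _)
  | and φ χ ih₁ ih₂ =>
    simp only [subs, List.mem_cons, List.mem_append] at h
    rcases h with rfl | h | h
    · rfl
    · exact (ih₁ h).trans ((le_max_left _ _).trans (Nat.le_succ _))
    · exact (ih₂ h).trans ((le_max_right _ _).trans (Nat.le_succ _))

theorem realize_congr {w : List Γ} (φ : WordFormula Γ) {v v' : ℕ → ℕ}
    (h : ∀ i < φ.bound, v i = v' i) : φ.Realize w v ↔ φ.Realize w v' := by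
  induction φ generalizing v v' with
  | le i j =>
    simp only [bound] at h
    simp only [Realize, h i (by omega), h j (by omega)]
  | add i j l =>
    simp only [bound] at h
    simp only [Realize, h i (by omega), h j (by omega), h l (by omega)]
  | letter i s =>
    simp only [bound] at h
    simp only [Realize, h i (by omega)]
  | not φ ih => exact not_congr (ih h)
  | and φ ψ ih₁ ih₂ =>
    simp only [bound] at h
    exact and_congr (ih₁ fun i hi => h i (by omega)) (ih₂ fun i hi => h i (by omega))
  | ex φ ih =>
    refine exists_congr fun y => and_congr_right fun _ => ih fun i hi => ?_
    cases i with
    | zero => rfl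
    | succ i => exact h i (Nat.lt_of_succ_lt hi)

/-! ### The circuit of a formula -/

section Gates

variable {n b : ℕ}

/-- The environment given by an assignment; the variable `i` is read modulo `b + 1`, which
is harmless since only the indices up to `b` occur. -/
def env (x : Fin (b + 1) → Fin (n + 1)) (i : ℕ) : ℕ := x (Fin.ofNat (b + 1) i)

theorem env_le (x : Fin (b + 1) → Fin (n + 1)) (i : ℕ) : env x i ≤ n := Fin.is_le _

open Classical in
/-- The gate of a formula at an assignment. An arithmetical atom is decided when the circuit is
built: it becomes a conjunction or disjunction without inputs, that is, a constant. -/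
noncomputable def gateKind (x : Fin (b + 1) → Fin (n + 1)) : WordFormula Γ → GateKind Γ n
  | le i j => if env x i ≤ env x j then .and else .or
  | add i j l => if env x i + env x j = env x l then .and else .or
  | letter i s => if h : env x i < n then .input ⟨env x i, h⟩ s else .or
  | not _ => .not
  | and _ _ => .and
  | ex _ => .or

/-- `Feeds ψ χ x y` says that the gate of `ψ` at `x` feeds into the gate of `χ` at `y`. -/
def Feeds (ψ χ : WordFormula Γ) (x y : Fin (b + 1) → Fin (n + 1)) : Prop :=
  match χ with
  | not φ => ψ = φ ∧ ∀ i, x i = y i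
  | and φ φ' => (ψ = φ ∨ ψ = φ') ∧ ∀ i, x i = y i
  | ex φ => ψ = φ ∧ ∀ i j : Fin (b + 1), (j : ℕ) = i + 1 → x j = y i
  | _ => False

theorem Feeds.depth_lt {ψ χ : WordFormula Γ} {x y : Fin (b + 1) → Fin (n + 1)}
    (h : Feeds ψ χ x y) : ψ.depth < χ.depth := by
  cases χ with
  | le | add | letter => exact h.elim
  | not φ | ex φ => obtain ⟨rfl, -⟩ := h; simp [depth]
  | and φ φ' => obtain ⟨rfl | rfl, -⟩ := h <;> simp [depth]

end Gates

/-- The circuit of the formula `φ` for words of length `n`. It has a gate for each subformula and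
each assignment of numbers to the variables that may occur in `φ`; its output is the gate of `φ` at
the assignment `0`. -/
noncomputable def circuit (φ : WordFormula Γ) (n : ℕ) : Circuit Γ n where
  Gate := {ψ // ψ ∈ φ.subs} × (Fin (φ.bound + 1) → Fin (n + 1))
  finite := by
    have : Finite {ψ // ψ ∈ φ.subs} := φ.subs.finite_toSet
    infer_instance
  kind g := gateKind g.2 g.1.1
  wire h g := Feeds h.1.1 g.1.1 h.2 g.2
  acyclic := Subrelation.wf (fun h => h.depth_lt)
    (InvImage.wf (fun g : {ψ // ψ ∈ φ.subs} × (Fin (φ.bound + 1) → Fin (n + 1)) => g.1.1.depth)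
      wellFounded_lt)
  not_fanIn := by
    rintro ⟨⟨χ, hχ⟩, x⟩ hk
    cases χ with
    | le | add | letter => simp only [gateKind] at hk; split_ifs at hk
    | and | ex => simp [gateKind] at hk
    | not ψ =>
      refine ⟨⟨⟨ψ, subs_subset hχ (by simp [subs, self_mem_subs])⟩, x⟩, ⟨rfl, fun _ => rfl⟩, ?_⟩
      rintro ⟨⟨ψ', h'⟩, x'⟩ ⟨h₁, h₂⟩
      obtain rfl : ψ' = ψ := h₁
      obtain rfl : x' = x := funext h₂
      rfl
  output := ⟨⟨φ, φ.self_mem_subs⟩, fun _ => 0⟩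

theorem circuit_isEvaluation (φ : WordFormula Γ) (w : List Γ) :
    (φ.circuit w.length).IsEvaluation w.get fun g => g.1.1.Realize w (env g.2) := by
  rintro ⟨⟨χ, hχ⟩, x⟩
  unfold Circuit.CorrectAt
  cases χ with
  | le i j | add i j l =>
    simp only [circuit, gateKind, Realize, Feeds]
    split_ifs with h <;> simp [h]
  | letter i s =>
    simp only [circuit, gateKind, Realize, Feeds]
    split_ifs with h
    · simp [List.getElem?_eq_getElem h]
    · simp [List.getElem?_eq_none (not_lt.1 h)]
  | not ψ =>
    have hψ : ψ ∈ φ.subs := subs_subset hχ (by simp [subs, self_mem_subs])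
    simp only [circuit, gateKind, Realize]
    constructor
    · rintro h ⟨⟨ψ', h'⟩, x'⟩ ⟨h₁, h₂⟩
      obtain rfl : ψ' = ψ := h₁
      obtain rfl : x' = x := funext h₂
      exact h
    · intro h
      exact h ⟨⟨ψ, hψ⟩, x⟩ ⟨rfl, fun _ => rfl⟩
  | and ψ ψ' =>
    have hψ : ψ ∈ φ.subs := subs_subset hχ (by simp [subs, self_mem_subs])
    have hψ' : ψ' ∈ φ.subs := subs_subset hχ (by simp [subs, self_mem_subs])
    simp only [circuit, gateKind, Realize]
    constructor
    · rintro ⟨h, h'⟩ ⟨⟨χ, _⟩, x'⟩ ⟨h₁, h₂⟩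
      obtain rfl : x' = x := funext h₂
      rcases h₁ with h₁ | h₁
      · obtain rfl : χ = ψ := h₁
        exact h
      · obtain rfl : χ = ψ' := h₁
        exact h'
    · intro h
      exact ⟨h ⟨⟨ψ, hψ⟩, x⟩ ⟨Or.inl rfl, fun _ => rfl⟩,
        h ⟨⟨ψ', hψ'⟩, x⟩ ⟨Or.inr rfl, fun _ => rfl⟩⟩
  | ex ψ =>
    have hψ : ψ ∈ φ.subs := subs_subset hχ (by simp [subs, self_mem_subs])
    have hb := bound_le_of_mem_subs hψ
    simp only [circuit, gateKind, Realize]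
    have key : ∀ x' : Fin (φ.bound + 1) → Fin (w.length + 1),
        (∀ i j : Fin (φ.bound + 1), (j : ℕ) = i + 1 → x' j = x i) →
          (ψ.Realize w (push (env x' 0) (env x)) ↔ ψ.Realize w (env x')) := by
      intro x' h
      refine realize_congr _ fun i hi => ?_
      cases i with
      | zero => rfl
      | succ i =>
        simp only [push_succ, env]
        rw [h (Fin.ofNat _ i) (Fin.ofNat _ (i + 1))]
        simp only [Fin.val_ofNat]
        rw [Nat.mod_eq_of_lt, Nat.mod_eq_of_lt] <;> omega
    constructor
    · rintro ⟨y, hy, h⟩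
      refine ⟨⟨⟨ψ, hψ⟩, fun j => if j = 0 then ⟨y, Nat.lt_succ_of_le hy⟩
        else x (Fin.ofNat _ (j - 1))⟩, ⟨rfl, ?_⟩, ?_⟩
      · intro i j hj
        have : j ≠ 0 := fun h => by simp [h] at hj
        simp only [this, if_false, hj, Nat.add_sub_cancel]
        congr 1
        ext
        simp
      · refine (key _ ?_).1 ?_
        · intro i j hj
          have : j ≠ 0 := fun h => by simp [h] at hj
          simp only [this, if_false, hj, Nat.add_sub_cancel]
          congr 1
          ext
          simp
        · simpa [env] using h
    · rintro ⟨⟨⟨ψ', h'⟩, x'⟩, ⟨h₁, h₂⟩, h⟩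
      obtain rfl : ψ' = ψ := h₁
      exact ⟨env x' 0, env_le _ _, (key x' h₂).2 h⟩

theorem circuit_accepts (φ : WordFormula Γ) (w : List Γ) :
    (φ.circuit w.length).Accepts w.get ↔ φ.Realize w fun _ => 0 := by
  have h := circuit_isEvaluation φ w
  constructor
  · rintro ⟨v, hv, hout⟩
    rw [((φ.circuit w.length).existsUnique_isEvaluation w.get).unique hv h] at hout
    exact hout
  · exact fun hr => ⟨_, h, hr⟩

end WordFormula
end AC0

namespace AC0
namespace WordFormula

open FirstOrder Language

variable {Γ : Type}

/-! ### Uniformity -/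

section Uniformity

def leF {α : Type} (i j : α) : arith.Formula α :=
  Relations.formula (L := arith) (n := 2) ArithRel.le ![Term.var i, Term.var j]

def addF {α : Type} (i j l : α) : arith.Formula α :=
  Relations.formula (L := arith) (n := 3) ArithRel.add ![Term.var i, Term.var j, Term.var l]

/-- The value of the variable is the largest number. -/
def lastF {α : Type} (i : α) : arith.Formula α :=
  BoundedFormula.all (n := 0) (Relations.boundedFormula (L := arith) (n := 2) ArithRel.le
    ![Term.var (Sum.inr 0), Term.var (Sum.inl i)])

def zeroF {α : Type} (i : α) : arith.Formula α := addF i i i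

variable {α : Type} {n : ℕ} {x : α → Fin (n + 1)}

theorem realize_leF {i j : α} : (leF i j).Realize x ↔ (x i : ℕ) ≤ x j := by
  exact Formula.realize_rel

theorem realize_addF {i j l : α} : (addF i j l).Realize x ↔ (x i : ℕ) + x j = x l := by
  exact Formula.realize_rel

theorem realize_lastF {i : α} : (lastF i).Realize x ↔ ¬ (x i : ℕ) < n := by
  simp only [lastF, Formula.Realize, BoundedFormula.realize_all]
  constructor
  · intro h
    have : n ≤ (x i : ℕ) := h (Fin.last n)
    omega
  · intro h a
    change (a : ℕ) ≤ x i
    omega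

theorem realize_zeroF {i : α} : (zeroF i).Realize x ↔ x i = 0 := by
  rw [zeroF, realize_addF, Fin.ext_iff, Fin.val_zero]
  omega

variable {b : ℕ}

/-- The assignments at which the gate of a formula is a conjunction. -/
def andF : WordFormula Γ → arith.Formula (Fin (b + 1))
  | le i j => leF (Fin.ofNat _ i) (Fin.ofNat _ j)
  | add i j l => addF (Fin.ofNat _ i) (Fin.ofNat _ j) (Fin.ofNat _ l)
  | and _ _ => ⊤
  | _ => ⊥

/-- The assignments at which the gate of a formula is a disjunction. -/
def orF : WordFormula Γ → arith.Formula (Fin (b + 1))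
  | le i j => ∼(leF (Fin.ofNat _ i) (Fin.ofNat _ j))
  | add i j l => ∼(addF (Fin.ofNat _ i) (Fin.ofNat _ j) (Fin.ofNat _ l))
  | letter i _ => lastF (Fin.ofNat _ i)
  | ex _ => ⊤
  | _ => ⊥

def notF : WordFormula Γ → arith.Formula (Fin (b + 1))
  | not _ => ⊤
  | _ => ⊥

open Classical in
/-- The assignments and positions for which the gate of a formula asks for the letter `s`. -/
noncomputable def inputF (s : Γ) : WordFormula Γ → arith.Formula (Fin (b + 1) ⊕ Fin 1)
  | letter i s' => if s' = s then
      Term.equal (Term.var (Sum.inl (Fin.ofNat _ i))) (Term.var (Sum.inr 0)) else ⊥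
  | _ => ⊥

/-- The equality of two assignments. -/
noncomputable def sameF : arith.Formula (Fin (b + 1) ⊕ Fin (b + 1)) :=
  Formula.iInf fun i : Fin (b + 1) => Term.equal (Term.var (Sum.inl i)) (Term.var (Sum.inr i))

open Classical in
/-- The relation `Feeds` as an arithmetical formula about the two assignments. -/
noncomputable def wireF (ψ : WordFormula Γ) :
    WordFormula Γ → arith.Formula (Fin (b + 1) ⊕ Fin (b + 1))
  | not φ => if ψ = φ then sameF else ⊥
  | and φ φ' => if ψ = φ ∨ ψ = φ' then sameF else ⊥
  | ex φ => if ψ = φ then Formula.iInf fun i : Fin (b + 1) => Formula.iInf fun j : Fin (b + 1) =>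
      if (j : ℕ) = i + 1 then Term.equal (Term.var (Sum.inl j)) (Term.var (Sum.inr i)) else ⊤
      else ⊥
  | _ => ⊥

theorem realize_leF_env {y : Fin (b + 1) → Fin (n + 1)} {i j : ℕ} :
    (leF (Fin.ofNat (b + 1) i) (Fin.ofNat _ j)).Realize y ↔ env y i ≤ env y j :=
  realize_leF

theorem realize_addF_env {y : Fin (b + 1) → Fin (n + 1)} {i j l : ℕ} :
    (addF (Fin.ofNat (b + 1) i) (Fin.ofNat _ j) (Fin.ofNat _ l)).Realize y ↔
      env y i + env y j = env y l :=
  realize_addF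

theorem realize_lastF_env {y : Fin (b + 1) → Fin (n + 1)} {i : ℕ} :
    (lastF (Fin.ofNat (b + 1) i)).Realize y ↔ ¬ env y i < n :=
  realize_lastF

theorem realize_andF (y : Fin (b + 1) → Fin (n + 1)) (ψ : WordFormula Γ) :
    gateKind y ψ = .and ↔ (andF ψ).Realize y := by
  cases ψ <;> simp only [gateKind, andF, realize_leF_env, realize_addF_env] <;>
    (try split_ifs) <;> simp_all

theorem realize_orF (y : Fin (b + 1) → Fin (n + 1)) (ψ : WordFormula Γ) :
    gateKind y ψ = .or ↔ (orF ψ).Realize y := by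
  cases ψ <;> simp only [gateKind, orF, realize_leF_env, realize_addF_env, realize_lastF_env,
    Formula.realize_not] <;> (try split_ifs) <;> simp_all

theorem realize_notF (y : Fin (b + 1) → Fin (n + 1)) (ψ : WordFormula Γ) :
    gateKind y ψ = .not ↔ (notF ψ).Realize y := by
  cases ψ <;> simp [gateKind, notF] <;> split_ifs <;> simp

theorem realize_inputF (y : Fin (b + 1) → Fin (n + 1)) (ψ : WordFormula Γ) (i : Fin n) (s : Γ) :
    gateKind y ψ = .input i s ↔ (inputF s ψ).Realize (Sum.elim y fun _ => i.castSucc) := by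
  cases ψ with
  | letter j s' =>
    simp only [gateKind, inputF]
    by_cases hs : s' = s
    · subst hs
      rw [if_pos rfl, Formula.realize_equal]
      simp only [Term.realize_var, Sum.elim_inl, Sum.elim_inr]
      change _ ↔ y (Fin.ofNat (b + 1) j) = i.castSucc
      rw [Fin.ext_iff, Fin.val_castSucc]
      change _ ↔ env y j = i
      have hi := i.2
      split_ifs with h
      · simp only [GateKind.input.injEq, and_true, Fin.ext_iff]
      · simp only [false_iff]
        omega
    · rw [if_neg hs]
      split_ifs with h <;> simp [hs]
  | _ => simp [gateKind, inputF] <;> split_ifs <;> simp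

theorem realize_sameF (y z : Fin (b + 1) → Fin (n + 1)) :
    sameF.Realize (Sum.elim y z) ↔ ∀ i, y i = z i := by
  simp [sameF]

theorem realize_wireF (y z : Fin (b + 1) → Fin (n + 1)) (ψ χ : WordFormula Γ) :
    Feeds ψ χ y z ↔ (wireF ψ χ).Realize (Sum.elim y z) := by
  cases χ with
  | le | add | letter => simp [Feeds, wireF]
  | not φ | and φ φ' =>
    simp only [Feeds, wireF]
    split_ifs with h <;> simp [h, realize_sameF]
  | ex φ =>
    simp only [Feeds, wireF]
    split_ifs with h
    · simp only [h, true_and, Formula.realize_iInf]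
      refine forall₂_congr fun i j => ?_
      split_ifs with hij <;> simp [hij]
    · simp [h]

end Uniformity

/-- The uniform description of the circuits of `φ`: the tags are the subformulas. -/
noncomputable def description (φ : WordFormula Γ) {N : ℕ} (e : {ψ // ψ ∈ φ.subs} ≃ Fin N) :
    Description Γ where
  tags := N
  width := φ.bound + 1
  gate _ := ⊤
  input t s := inputF s (e.symm t).1
  and t := andF (e.symm t).1
  or t := orF (e.symm t).1
  not t := notF (e.symm t).1
  wire t t' := wireF (e.symm t).1 (e.symm t').1
  output t := open Classical in
    if (e.symm t).1 = φ then Formula.iInf fun i => zeroF i else ⊥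

theorem description_describes (φ : WordFormula Γ) {N : ℕ} (e : {ψ // ψ ∈ φ.subs} ≃ Fin N) (n : ℕ) :
    (φ.description e).Describes (φ.circuit n) := by
  refine ⟨fun g => e g.1, fun g => g.2, ?_, ?_, ?_, ?_, ?_, ?_, ?_, ?_⟩
  · rintro ⟨a, x⟩ ⟨c, y⟩ h
    have h' : (e a, x) = (e c, y) := h
    exact Prod.ext (e.injective (congrArg Prod.fst h')) (congrArg Prod.snd h' :)
  · intro t x
    exact iff_of_true (Formula.realize_top.2 trivial) ⟨(e.symm t, x), e.apply_symm_apply t, rfl⟩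
  · intro g i s
    simp only [description, Equiv.symm_apply_apply]
    exact realize_inputF _ _ _ _
  · intro g
    simp only [description, Equiv.symm_apply_apply]
    exact realize_andF _ _
  · intro g
    simp only [description, Equiv.symm_apply_apply]
    exact realize_orF _ _
  · intro g
    simp only [description, Equiv.symm_apply_apply]
    exact realize_notF _ _
  · intro h g
    simp only [description, Equiv.symm_apply_apply]
    exact realize_wireF _ _ _ _
  · rintro ⟨⟨ψ, hψ⟩, x⟩
    have hψ' : (e.symm (e ⟨ψ, hψ⟩)).1 = ψ := by rw [e.symm_apply_apply]
    simp only [description, circuit]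
    split_ifs with h
    · simp only [Formula.realize_iInf, realize_zeroF]
      exact ⟨fun h' => congrFun (congrArg Prod.snd h' :),
        fun h' => Prod.ext (Subtype.ext (hψ'.symm.trans h)) (funext h')⟩
    · refine iff_of_false (fun h' => h (hψ'.trans ?_)) id
      exact congrArg (fun g : {ψ // ψ ∈ φ.subs} × (Fin (φ.bound + 1) → Fin (n + 1)) => g.1.1) h'

/-- Every first-order definable language is in uniform AC⁰. -/
theorem inAC0 [Finite Γ] (φ : WordFormula Γ) : InAC0 {w : List Γ | φ.Realize w fun _ => 0} := by
  have hfin : Finite {ψ // ψ ∈ φ.subs} := φ.subs.finite_toSet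
  refine ⟨φ.circuit, ⟨φ.depth, fun n => ⟨fun g => g.1.1.depth, fun g =>
      depth_le_of_mem_subs g.1.2, fun _ _ h => h.depth_lt⟩⟩,
    ⟨Polynomial.C (Nat.card {ψ // ψ ∈ φ.subs}) * (Polynomial.X + 1) ^ (φ.bound + 1), fun n => ?_⟩,
    ⟨φ.description (Finite.equivFin _), φ.description_describes _⟩, φ.circuit_accepts⟩
  simp only [Circuit.size, circuit]
  rw [Nat.card_prod]
  simp

end WordFormula
end AC0

/-! ### First-order definable predicates, functions and numbers -/

namespace AC0

variable {Γ : Type}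

/-- An environment whose values are at most the length of the word. -/
def Bounded (w : List Γ) (v : ℕ → ℕ) : Prop := ∀ i, v i ≤ w.length

theorem Bounded.push {w : List Γ} {v : ℕ → ℕ} (h : Bounded w v) {y : ℕ} (hy : y ≤ w.length) :
    Bounded w (push y v)
  | 0 => hy
  | i + 1 => h i

/-- The predicate `P` of words and environments is first-order definable. -/
def FO (P : List Γ → (ℕ → ℕ) → Prop) : Prop :=
  ∃ φ : WordFormula Γ, ∀ w v, Bounded w v → (φ.Realize w v ↔ P w v)

/-- The function `F` with values bounded by the length of the word is first-order definable: its
graph is, with the value of the function in front of the environment. -/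
structure FOFun (Γ : Type) (F : List Γ → (ℕ → ℕ) → ℕ) : Prop where
  le_length : ∀ w v, Bounded w v → F w v ≤ w.length
  graph : FO fun w v => v 0 = F w fun i => v (i + 1)

/-- Renaming of free variables; below a quantifier the bound variable `0` stays in place. -/
def WordFormula.rename : WordFormula Γ → (ℕ → ℕ) → WordFormula Γ
  | le i j, f => le (f i) (f j)
  | add i j l, f => add (f i) (f j) (f l)
  | letter i s, f => letter (f i) s
  | not φ, f => not (φ.rename f)
  | and φ ψ, f => and (φ.rename f) (ψ.rename f)
  | ex φ, f => ex (φ.rename (push 0 fun i => f i + 1))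

theorem WordFormula.realize_rename {w : List Γ} (φ : WordFormula Γ) (f v : ℕ → ℕ) :
    (φ.rename f).Realize w v ↔ φ.Realize w fun i => v (f i) := by
  induction φ generalizing f v with
  | le | add | letter => rfl
  | not φ ih => exact not_congr (ih f v)
  | and φ ψ ih₁ ih₂ => exact and_congr (ih₁ f v) (ih₂ f v)
  | ex φ ih =>
    refine exists_congr fun y => and_congr_right fun _ => (ih _ _).trans (iff_of_eq ?_)
    congr 1
    funext i
    cases i <;> rfl

namespace FO

variable {P Q : List Γ → (ℕ → ℕ) → Prop}

theorem congr (h : FO P) (hPQ : ∀ w v, Bounded w v → (P w v ↔ Q w v)) : FO Q :=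
  let ⟨φ, hφ⟩ := h
  ⟨φ, fun w v hv => (hφ w v hv).trans (hPQ w v hv)⟩

protected theorem not (h : FO P) : FO fun w v => ¬ P w v :=
  let ⟨φ, hφ⟩ := h
  ⟨φ.not, fun w v hv => not_congr (hφ w v hv)⟩

protected theorem and (hP : FO P) (hQ : FO Q) : FO fun w v => P w v ∧ Q w v :=
  let ⟨φ, hφ⟩ := hP
  let ⟨ψ, hψ⟩ := hQ
  ⟨φ.and ψ, fun w v hv => and_congr (hφ w v hv) (hψ w v hv)⟩

protected theorem or (hP : FO P) (hQ : FO Q) : FO fun w v => P w v ∨ Q w v :=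
  (hP.not.and hQ.not).not.congr fun _ _ _ => by tauto

protected theorem imp (hP : FO P) (hQ : FO Q) : FO fun w v => P w v → Q w v :=
  (hP.and hQ.not).not.congr fun _ _ _ => by tauto

protected theorem iff (hP : FO P) (hQ : FO Q) : FO fun w v => P w v ↔ Q w v :=
  ((hP.imp hQ).and (hQ.imp hP)).congr fun _ _ _ => by tauto

theorem const (p : Prop) : FO (Γ := Γ) fun _ _ => p := by
  have h : FO (Γ := Γ) fun _ v => v 0 ≤ v 0 := ⟨.le 0 0, fun _ _ _ => Iff.rfl⟩
  by_cases hp : p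
  · exact h.congr fun _ _ _ => by simp [hp]
  · exact h.not.congr fun _ _ _ => by simp [hp]

theorem ex {P : List Γ → (ℕ → ℕ) → ℕ → Prop} (h : FO fun w v => P w (fun i => v (i + 1)) (v 0)) :
    FO fun w v => ∃ y ≤ w.length, P w v y :=
  let ⟨φ, hφ⟩ := h
  ⟨φ.ex, fun w _ hv => exists_congr fun _ => and_congr_right fun hy => hφ w _ (hv.push hy)⟩

theorem all {P : List Γ → (ℕ → ℕ) → ℕ → Prop} (h : FO fun w v => P w (fun i => v (i + 1)) (v 0)) :
    FO fun w v => ∀ y ≤ w.length, P w v y :=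
  (FO.ex (P := fun w v y => ¬ P w v y) h.not).not.congr fun _ _ _ => by push Not; rfl

theorem rename (h : FO P) (f : ℕ → ℕ) : FO fun w v => P w fun i => v (f i) :=
  let ⟨φ, hφ⟩ := h
  ⟨φ.rename f, fun w _ hv => (φ.realize_rename f _).trans (hφ w _ fun i => hv (f i))⟩

theorem weak (h : FO P) : FO fun w v => P w fun i => v (i + 1) := h.rename _

theorem exists_finite {ι : Type} [Finite ι] {P : ι → List Γ → (ℕ → ℕ) → Prop}
    (h : ∀ i, FO (P i)) : FO fun w v => ∃ i, P i w v := by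
  have key : ∀ l : List ι, FO fun w v => ∃ i ∈ l, P i w v := by
    intro l
    induction l with
    | nil => exact (const False).congr fun _ _ _ => by simp
    | cons a l ih => exact ((h a).or ih).congr fun _ _ _ => by simp
  cases nonempty_fintype ι
  exact (key Finset.univ.toList).congr fun _ _ _ => by simp

theorem forall_finite {ι : Type} [Finite ι] {P : ι → List Γ → (ℕ → ℕ) → Prop}
    (h : ∀ i, FO (P i)) : FO fun w v => ∀ i, P i w v :=
  (exists_finite fun i => (h i).not).not.congr fun _ _ _ => by push Not; rfl

theorem forall_mem {ι : Type} {P : ι → List Γ → (ℕ → ℕ) → Prop} (l : List ι)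
    (h : ∀ i, FO (P i)) : FO fun w v => ∀ i ∈ l, P i w v := by
  induction l with
  | nil => exact (const True).congr fun _ _ _ => by simp
  | cons a l ih => exact ((h a).and ih).congr fun _ _ _ => by simp

/-- A definable function can be inserted for a variable of a definable predicate. -/
theorem subst {F : List Γ → (ℕ → ℕ) → ℕ} {P : List Γ → (ℕ → ℕ) → ℕ → Prop}
    (h : FO fun w v => P w (fun i => v (i + 1)) (v 0)) (hF : FOFun Γ F) :
    FO fun w v => P w v (F w v) := by
  refine (FO.ex (P := fun w v y => y = F w v ∧ P w v y) (hF.graph.and h)).congr fun w v hv => ?_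
  constructor
  · rintro ⟨y, -, rfl, h⟩
    exact h
  · exact fun h => ⟨_, hF.le_length w v hv, rfl, h⟩

/-- Quantification over all free variables at once. -/
theorem exists_env (h : FO P) : FO fun w _ => ∃ u, Bounded w u ∧ P w u := by
  obtain ⟨φ, hφ⟩ := h
  have key : ∀ (w : List Γ) (K : ℕ) (φ : WordFormula Γ) (v : ℕ → ℕ), Bounded w v →
      ((WordFormula.ex^[K] φ).Realize w v ↔
        ∃ u, Bounded w u ∧ φ.Realize w fun i => if i < K then u i else v (i - K)) := by
    intro w K
    induction K with
    | zero => exact fun φ v hv => ⟨fun h => ⟨v, hv, by simpa using h⟩, fun ⟨_, _, h⟩ => by simpa using h⟩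
    | succ K ih =>
      intro φ v hv
      rw [Function.iterate_succ_apply, ih _ v hv]
      constructor
      · rintro ⟨u, hu, y, hy, h⟩
        refine ⟨push y u, hu.push hy, (iff_of_eq ?_).1 h⟩
        congr 1
        funext i
        cases i <;> simp
      · rintro ⟨u, hu, h⟩
        refine ⟨fun i => u (i + 1), fun i => hu _, u 0, hu 0, (iff_of_eq ?_).1 h⟩
        congr 1
        funext i
        cases i <;> simp
  refine ⟨WordFormula.ex^[φ.bound] φ, fun w v hv => (key w _ φ v hv).trans ?_⟩
  refine exists_congr fun u => and_congr_right fun hu => ?_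
  rw [← hφ w u hu]
  exact WordFormula.realize_congr _ fun i hi => if_pos hi

end FO

namespace FOFun

variable {F G H : List Γ → (ℕ → ℕ) → ℕ}

theorem var (i : ℕ) : FOFun Γ fun _ v => v i where
  le_length _ _ hv := hv i
  graph := (FO.and ⟨.le 0 (i + 1), fun _ _ _ => Iff.rfl⟩
    ⟨.le (i + 1) 0, fun _ _ _ => Iff.rfl⟩).congr fun _ _ _ => le_antisymm_iff.symm

theorem weak (h : FOFun Γ F) : FOFun Γ fun w v => F w fun i => v (i + 1) where
  le_length w _ hv := h.le_length w _ fun i => hv (i + 1)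
  graph := h.graph.rename (push 0 fun i => i + 2)

end FOFun

namespace FO

variable {F G H : List Γ → (ℕ → ℕ) → ℕ}

theorem le (hF : FOFun Γ F) (hG : FOFun Γ G) : FO fun w v => F w v ≤ G w v :=
  (FO.subst (P := fun w v y => y ≤ G w v)
    (FO.subst (P := fun _ v y => v 0 ≤ y) ⟨.le 1 0, fun _ _ _ => Iff.rfl⟩ hG.weak) hF)

theorem add (hF : FOFun Γ F) (hG : FOFun Γ G) (hH : FOFun Γ H) :
    FO fun w v => F w v + G w v = H w v :=
  (FO.subst (P := fun w v y => y + G w v = H w v)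
    (FO.subst (P := fun w v y => v 0 + y = H w fun i => v (i + 1))
      (FO.subst (P := fun _ v y => v 1 + v 0 = y) ⟨.add 2 1 0, fun _ _ _ => Iff.rfl⟩
        hH.weak.weak) hG.weak) hF)

theorem letter (hF : FOFun Γ F) (s : Γ) : FO fun w v => w[F w v]? = some s :=
  FO.subst (P := fun w _ y => w[y]? = some s) ⟨.letter 0 s, fun _ _ _ => Iff.rfl⟩ hF

theorem lt (hF : FOFun Γ F) (hG : FOFun Γ G) : FO fun w v => F w v < G w v :=
  (FO.le hG hF).not.congr fun _ _ _ => not_le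

theorem eq (hF : FOFun Γ F) (hG : FOFun Γ G) : FO fun w v => F w v = G w v :=
  ((FO.le hF hG).and (FO.le hG hF)).congr fun _ _ _ => le_antisymm_iff.symm

theorem eq_const (hF : FOFun Γ F) (c : ℕ) : FO fun w v => F w v = c := by
  induction c generalizing F with
  | zero => exact (FO.add hF hF hF).congr fun _ _ _ => by omega
  | succ c ih =>
    refine (FO.ex (P := fun w v y => (y = c ∧ y < F w v) ∧
      ∀ z ≤ w.length, z < F w v → z ≤ y) ?_).congr fun w v hv => ?_
    · exact ((ih (.var 0)).and (.lt (.var 0) hF.weak)).and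
        (.all (.imp (.lt (.var 0) hF.weak.weak) (.le (.var 0) (.var 1))))
    · have := hF.le_length w v hv
      constructor
      · rintro ⟨y, hy, ⟨rfl, h⟩, h'⟩
        by_contra hne
        have := h' (y + 1) (by omega) (by omega)
        omega
      · exact fun h => ⟨c, by omega, ⟨rfl, by omega⟩, fun z _ hz => by omega⟩

end FO

namespace FOFun

theorem length : FOFun Γ fun w _ => w.length where
  le_length _ _ _ := le_rfl
  graph := (FO.all (P := fun _ v y => y ≤ v 0) (.le (.var 0) (.var 1))).congr fun _ _ hv =>
    ⟨fun h => le_antisymm (hv 0) (h _ le_rfl), fun h _ hy => h ▸ hy⟩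

/-- The constant `c`, cut off at the length of the word. -/
theorem const (c : ℕ) : FOFun Γ fun w _ => min c w.length where
  le_length _ _ _ := min_le_right _ _
  graph := ((FO.eq_const (.var 0) c).or ((FO.eq (.var 0) .length).and (.exists_finite
    (P := fun (i : Fin c) w _ => w.length = i) fun i => FO.eq_const .length i))).congr
    fun w v hv => by
      have := hv 0
      constructor
      · rintro (h | ⟨h, i, hi⟩)
        · rw [h, min_eq_left (h ▸ this)]
        · rw [h, min_eq_right (hi ▸ i.2.le)]
      · intro h
        rcases le_or_gt c w.length with hc | hc
        · exact Or.inl (h.trans (min_eq_left hc))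
        · exact Or.inr ⟨h.trans (min_eq_right hc.le), ⟨w.length, hc⟩, rfl⟩

end FOFun

/-! ### Numbers that may exceed the length of the word -/

/-- `c i` is the carry at the bit `i` if carries are generated by `g` and propagated by `p`. -/
theorem carry_lookahead {c g p : ℕ → Prop} (h₀ : ¬ c 0) (hs : ∀ i, c (i + 1) ↔ g i ∨ p i ∧ c i)
    (i : ℕ) : c i ↔ ∃ j < i, g j ∧ ∀ k, j < k → k < i → p k := by
  induction i with
  | zero => simp [h₀]
  | succ i ih =>
    rw [hs, ih]
    constructor
    · rintro (h | ⟨h, j, hj, hg, hp⟩)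
      · exact ⟨i, by omega, h, fun k _ _ => by omega⟩
      · refine ⟨j, by omega, hg, fun k hjk hki => ?_⟩
        rcases Nat.lt_succ_iff_lt_or_eq.1 hki with hk | rfl
        · exact hp k hjk hk
        · exact h
    · rintro ⟨j, hj, hg, hp⟩
      rcases Nat.lt_succ_iff_lt_or_eq.1 hj with hj' | rfl
      · exact Or.inr ⟨hp i hj' (by omega), j, hj', hg, fun k h₁ h₂ => hp k h₁ (by omega)⟩
      · exact Or.inl hg

theorem mod_two_pow_succ (x i : ℕ) :
    x % 2 ^ (i + 1) = x % 2 ^ i + if x.testBit i then 2 ^ i else 0 := by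
  rw [Nat.mod_pow_succ, Nat.testBit_eq_decide_div_mod_eq]
  rcases Nat.mod_two_eq_zero_or_one (x / 2 ^ i) with h | h <;> simp [h]

theorem add_carry_iff (x y i : ℕ) : 2 ^ i ≤ x % 2 ^ i + y % 2 ^ i ↔
    ∃ j < i, (x.testBit j ∧ y.testBit j) ∧ ∀ k, j < k → k < i → (x.testBit k ∨ y.testBit k) := by
  refine carry_lookahead (c := fun i => 2 ^ i ≤ x % 2 ^ i + y % 2 ^ i) ?_ ?_ i
  · simp [Nat.mod_one]
  · intro i
    have hx := Nat.mod_lt x (Nat.two_pow_pos i)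
    have hy := Nat.mod_lt y (Nat.two_pow_pos i)
    rw [mod_two_pow_succ x, mod_two_pow_succ y, pow_succ]
    by_cases h₁ : x.testBit i <;> by_cases h₂ : y.testBit i <;> simp [h₁, h₂] <;> omega

theorem mod_lt_mod_iff (x y i : ℕ) : y % 2 ^ i < x % 2 ^ i ↔
    ∃ j < i, (x.testBit j ∧ ¬ y.testBit j) ∧
      ∀ k, j < k → k < i → (x.testBit k ∨ ¬ y.testBit k) := by
  refine carry_lookahead (c := fun i => y % 2 ^ i < x % 2 ^ i) ?_ ?_ i
  · simp [Nat.mod_one]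
  · intro i
    have hx := Nat.mod_lt x (Nat.two_pow_pos i)
    have hy := Nat.mod_lt y (Nat.two_pow_pos i)
    simp only [mod_two_pow_succ]
    by_cases h₁ : x.testBit i <;> by_cases h₂ : y.testBit i <;> simp [h₁, h₂] <;> omega

theorem testBit_add_iff (x y i : ℕ) : (x + y).testBit i ↔
    ((x.testBit i ↔ y.testBit i) ↔ 2 ^ i ≤ x % 2 ^ i + y % 2 ^ i) := by
  simp only [Nat.testBit_eq_decide_div_mod_eq, decide_eq_true_eq, Nat.add_div (Nat.two_pow_pos i)]
  split_ifs with h <;> simp only [h, iff_true, iff_false] <;> omega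

end AC0

namespace AC0

variable {Γ : Type}

/-- A number that depends on the word and the environment, such as the value of a block of binary
digits, and that may be larger than the length `n` of the word: its bits are definable, and its
part above `2 ^ n` has finitely many values, each of them definable. -/
structure FONum (Γ : Type) (N : List Γ → (ℕ → ℕ) → ℕ) : Prop where
  bit : FO fun w v => (N w fun i => v (i + 1)).testBit (v 0)
  high (k : ℕ) : FO fun w v => N w v / 2 ^ w.length = k
  bounded : ∃ B, ∀ w v, Bounded w v → N w v / 2 ^ w.length ≤ B

namespace FONum

variable {M N : List Γ → (ℕ → ℕ) → ℕ} {F : List Γ → (ℕ → ℕ) → ℕ}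

theorem testBit (hN : FONum Γ N) (hF : FOFun Γ F) : FO fun w v => (N w v).testBit (F w v) :=
  FO.subst (P := fun w v y => (N w v).testBit y) hN.bit hF

theorem weak (hN : FONum Γ N) : FONum Γ fun w v => N w fun i => v (i + 1) where
  bit := hN.bit.rename (push 0 fun i => i + 2)
  high k := (hN.high k).weak
  bounded := hN.bounded.imp fun _ h w _ hv => h w _ fun i => hv (i + 1)

theorem carry (hM : FONum Γ M) (hN : FONum Γ N) (hF : FOFun Γ F) :
    FO fun w v => 2 ^ F w v ≤ M w v % 2 ^ F w v + N w v % 2 ^ F w v := by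
  refine (FO.ex (P := fun w v j => (j < F w v ∧ (M w v).testBit j ∧ (N w v).testBit j) ∧
    ∀ k ≤ w.length, j < k → k < F w v → ((M w v).testBit k ∨ (N w v).testBit k)) ?_).congr
    fun w v hv => ?_
  · exact ((FO.lt (.var 0) hF.weak).and
      ((hM.weak.testBit (.var 0)).and (hN.weak.testBit (.var 0)))).and
      (.all (.imp (.lt (.var 1) (.var 0)) (.imp (.lt (.var 0) hF.weak.weak)
        ((hM.weak.weak.testBit (.var 0)).or (hN.weak.weak.testBit (.var 0))))))
  · have hF := hF.le_length w v hv
    rw [add_carry_iff]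
    constructor
    · rintro ⟨j, -, ⟨h₁, h₂⟩, h₃⟩
      exact ⟨j, h₁, h₂, fun k hjk hk => h₃ k (by omega) hjk hk⟩
    · rintro ⟨j, h₁, h₂, h₃⟩
      exact ⟨j, by omega, ⟨h₁, h₂⟩, fun k _ => h₃ k⟩

theorem mod_lt_mod (hM : FONum Γ M) (hN : FONum Γ N) (hF : FOFun Γ F) :
    FO fun w v => N w v % 2 ^ F w v < M w v % 2 ^ F w v := by
  refine (FO.ex (P := fun w v j => (j < F w v ∧ (M w v).testBit j ∧ ¬ (N w v).testBit j) ∧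
    ∀ k ≤ w.length, j < k → k < F w v → ((M w v).testBit k ∨ ¬ (N w v).testBit k)) ?_).congr
    fun w v hv => ?_
  · exact ((FO.lt (.var 0) hF.weak).and
      ((hM.weak.testBit (.var 0)).and (hN.weak.testBit (.var 0)).not)).and
      (.all (.imp (.lt (.var 1) (.var 0)) (.imp (.lt (.var 0) hF.weak.weak)
        ((hM.weak.weak.testBit (.var 0)).or (hN.weak.weak.testBit (.var 0)).not))))
  · have hF := hF.le_length w v hv
    rw [mod_lt_mod_iff]
    constructor
    · rintro ⟨j, -, ⟨h₁, h₂⟩, h₃⟩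
      exact ⟨j, h₁, h₂, fun k hjk hk => h₃ k (by omega) hjk hk⟩
    · rintro ⟨j, h₁, h₂, h₃⟩
      exact ⟨j, by omega, ⟨h₁, h₂⟩, fun k _ => h₃ k⟩

protected theorem add (hM : FONum Γ M) (hN : FONum Γ N) : FONum Γ fun w v => M w v + N w v where
  bit := (((hM.weak.testBit (.var 0)).iff (hN.weak.testBit (.var 0))).iff
    (hM.weak.carry hN.weak (.var 0))).congr fun _ _ _ => (testBit_add_iff _ _ _).symm
  high k := by
    refine (FO.exists_finite (P := fun (i : Fin (k + 1) × Fin (k + 1)) w v =>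
      (M w v / 2 ^ w.length = i.1 ∧ N w v / 2 ^ w.length = i.2) ∧
        ((2 ^ w.length ≤ M w v % 2 ^ w.length + N w v % 2 ^ w.length → (i.1 : ℕ) + i.2 + 1 = k) ∧
        (¬ 2 ^ w.length ≤ M w v % 2 ^ w.length + N w v % 2 ^ w.length → (i.1 : ℕ) + i.2 = k)))
      fun i => ((hM.high _).and (hN.high _)).and (((hM.carry hN .length).imp (.const _)).and
        ((hM.carry hN .length).not.imp (.const _)))).congr fun w v _ => ?_
    rw [Nat.add_div (Nat.two_pow_pos _)]
    constructor
    · rintro ⟨i, ⟨h₁, h₂⟩, h₃, h₄⟩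
      rw [h₁, h₂]
      split_ifs with h
      · exact h₃ h
      · exact h₄ h
    · intro h
      refine ⟨(⟨M w v / 2 ^ w.length, ?_⟩, ⟨N w v / 2 ^ w.length, ?_⟩), ⟨rfl, rfl⟩, ?_, ?_⟩
      · rw [← h]
        exact Nat.lt_succ_of_le ((Nat.le_add_right _ _).trans (Nat.le_add_right _ _))
      · rw [← h]
        exact Nat.lt_succ_of_le ((Nat.le_add_left _ _).trans (Nat.le_add_right _ _))
      · intro hc
        rwa [if_pos hc] at h
      · intro hc
        rwa [if_neg hc] at h
  bounded := by
    obtain ⟨B, hB⟩ := hM.bounded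
    obtain ⟨C, hC⟩ := hN.bounded
    refine ⟨B + C + 1, fun w v hv => ?_⟩
    have h₁ := hB w v hv
    have h₂ := hC w v hv
    rw [Nat.add_div (Nat.two_pow_pos _)]
    split_ifs <;> omega

theorem const (c : ℕ) : FONum Γ fun _ _ => c where
  bit := by
    refine (FO.exists_finite (P := fun (j : Fin c) _ v => v 0 = j ∧ c.testBit j)
      fun j => (FO.eq_const (.var 0) j).and (.const _)).congr fun w v _ => ?_
    constructor
    · rintro ⟨j, h, h'⟩
      rwa [h]
    · intro h
      exact ⟨⟨v 0, Nat.lt_two_pow_self.trans_le (Nat.ge_two_pow_of_testBit h)⟩, rfl, h⟩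
  high k := by
    refine ((FO.exists_finite (P := fun (j : Fin c) w _ => w.length = j ∧ c / 2 ^ (j : ℕ) = k)
      fun j => (FO.eq_const .length j).and (.const _)).or
      ((FO.forall_finite (P := fun (j : Fin c) w _ => ¬ w.length = j)
      fun j => (FO.eq_const .length j).not).and (.const (0 = k)))).congr fun w v _ => ?_
    by_cases hc : w.length < c
    · constructor
      · rintro (⟨j, h, h'⟩ | ⟨h, -⟩)
        · rwa [h]
        · exact absurd rfl (h ⟨_, hc⟩)
      · exact fun h => Or.inl ⟨⟨_, hc⟩, rfl, h⟩
    · have h0 : c / 2 ^ w.length = 0 :=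
        Nat.div_eq_of_lt ((not_lt.1 hc).trans_lt Nat.lt_two_pow_self)
      rw [h0]
      constructor
      · rintro (⟨j, h, -⟩ | ⟨-, h⟩)
        · exact absurd (h ▸ j.2) hc
        · exact h
      · exact fun h => Or.inr ⟨fun j h => hc (h ▸ j.2), h⟩
  bounded := ⟨c, fun _ _ _ => Nat.div_le_self _ _⟩

theorem const_mul (c : ℕ) (hN : FONum Γ N) : FONum Γ fun w v => c * N w v := by
  induction c with
  | zero => simpa only [zero_mul] using FONum.const 0
  | succ c ih => simpa only [add_mul, one_mul] using ih.add hN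

theorem lt (hM : FONum Γ M) (hN : FONum Γ N) : FO fun w v => N w v < M w v := by
  obtain ⟨B, hB⟩ := hM.bounded
  obtain ⟨C, hC⟩ := hN.bounded
  refine (FO.exists_finite (P := fun (i : Fin (B + 1) × Fin (C + 1)) w v =>
    (M w v / 2 ^ w.length = i.1 ∧ N w v / 2 ^ w.length = i.2) ∧ ((i.2 : ℕ) < i.1 ∨
      ((i.2 : ℕ) = i.1 ∧ N w v % 2 ^ w.length < M w v % 2 ^ w.length))) fun i =>
    ((hM.high _).and (hN.high _)).and
      ((FO.const _).or ((FO.const _).and (hM.mod_lt_mod hN .length)))).congr fun w v hv => ?_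
  have hM' := Nat.div_add_mod (M w v) (2 ^ w.length)
  have hN' := Nat.div_add_mod (N w v) (2 ^ w.length)
  have hlM := Nat.mod_lt (M w v) (Nat.two_pow_pos w.length)
  have hlN := Nat.mod_lt (N w v) (Nat.two_pow_pos w.length)
  constructor
  · rintro ⟨i, ⟨h₁, h₂⟩, h | ⟨h, h'⟩⟩
    · rw [← h₁, ← h₂] at h
      have := Nat.mul_le_mul_left (2 ^ w.length) (Nat.succ_le_of_lt h)
      rw [Nat.mul_succ] at this
      omega
    · rw [← h₁, ← h₂] at h
      rw [h] at hN'
      omega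
  · intro h
    refine ⟨(⟨_, Nat.lt_succ_of_le (hB w v hv)⟩, ⟨_, Nat.lt_succ_of_le (hC w v hv)⟩),
      ⟨rfl, rfl⟩, ?_⟩
    rcases (Nat.div_le_div_right (c := 2 ^ w.length) h.le).lt_or_eq with h' | h'
    · exact Or.inl h'
    · refine Or.inr ⟨h', ?_⟩
      rw [h'] at hN'
      omega

theorem le (hM : FONum Γ M) (hN : FONum Γ N) : FO fun w v => M w v ≤ N w v :=
  (hM.lt hN).not.congr fun _ _ _ => not_lt

theorem eq (hM : FONum Γ M) (hN : FONum Γ N) : FO fun w v => M w v = N w v :=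
  ((hM.le hN).and (hN.le hM)).congr fun _ _ _ => le_antisymm_iff.symm

end FONum

/-- Every language defined by a first-order sentence is in uniform AC⁰. -/
theorem FO.inAC0 [Finite Γ] {P : List Γ → (ℕ → ℕ) → Prop} (h : FO P) :
    InAC0 {w | P w fun _ => 0} := by
  obtain ⟨φ, hφ⟩ := h
  convert φ.inAC0 using 2
  ext w
  exact (hφ w _ fun _ => Nat.zero_le _).symm

end AC0

/-! ### Reading numbers, assertions and answers off a word -/

namespace FuzzyDL

open AC0

/-- The number with the given binary digits, least significant first; a letter other than `one`
counts as the digit `0`. -/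
def ofDigits : List Letter → ℕ
  | [] => 0
  | l :: t => Nat.bit (decide (l = .one)) (ofDigits t)

/-- The number written at the beginning of a word, up to the first separator. -/
def readNat (t : List Letter) : ℕ := ofDigits (t.takeWhile (· ≠ .sep))

theorem takeWhile_encodeNat (n : ℕ) (r : List Letter) :
    (encodeNat n ++ r).takeWhile (· ≠ .sep) =
      n.bits.map fun b => if b then Letter.one else Letter.zero := by
  rw [encodeNat, List.append_assoc, List.takeWhile_append_of_pos]
  · simp
  · intro l hl
    obtain ⟨b, -, rfl⟩ := List.mem_map.1 hl
    cases b <;> simp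

theorem ofDigits_bits (n : ℕ) :
    ofDigits (n.bits.map fun b => if b then Letter.one else Letter.zero) = n := by
  induction n using Nat.binaryRec' with
  | zero => rfl
  | bit b n h ih =>
    rw [Nat.bits_append_bit _ _ h, List.map_cons, ofDigits, ih]
    cases b <;> simp

theorem readNat_encodeNat (n : ℕ) (r : List Letter) : readNat (encodeNat n ++ r) = n := by
  rw [readNat, takeWhile_encodeNat, ofDigits_bits]

theorem readNat_lt (t : List Letter) : readNat t < 2 ^ t.length := by
  have h : ∀ l : List Letter, ofDigits l < 2 ^ l.length := by
    intro l
    induction l with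
    | nil => simp [ofDigits]
    | cons a l ih =>
      rw [ofDigits, List.length_cons, pow_succ, Nat.bit_val]
      have : (decide (a = Letter.one)).toNat ≤ 1 := Bool.toNat_le _
      omega
  exact (h _).trans_le (Nat.pow_le_pow_right two_pos (List.takeWhile_sublist _).length_le)

theorem testBit_readNat (t : List Letter) (i : ℕ) :
    (readNat t).testBit i ↔ t[i]? = some .one ∧ ∀ j < i, t[j]? ≠ some .sep := by
  unfold readNat
  induction t generalizing i with
  | nil => simp [ofDigits]
  | cons a t ih =>
    by_cases ha : a = .sep
    · subst ha
      cases i with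
      | zero => simp [ofDigits]
      | succ i =>
        simp only [ne_eq, not_true_eq_false, decide_false, Bool.false_eq_true,
          not_false_eq_true, List.takeWhile_cons_of_neg, ofDigits, Nat.zero_testBit, false_iff,
          not_and, not_forall]
        exact fun _ => ⟨0, Nat.succ_pos i, by simp⟩
    · rw [List.takeWhile_cons_of_pos (by simpa using ha), ofDigits]
      cases i with
      | zero => simp
      | succ i =>
        rw [Nat.testBit_bit_succ, ih, List.getElem?_cons_succ, Nat.forall_lt_succ_left]
        simp [ha]

/-- The position after the first separator at or after the position `s`. -/
def nextField (w : List Letter) (s : ℕ) : ℕ :=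
  min w.length (s + ((w.drop s).takeWhile (· ≠ .sep)).length + 1)

/-- The position after `p`, cut off at the end of the word. -/
def succPos (w : List Letter) (p : ℕ) : ℕ := min w.length (p + 1)

theorem length_takeWhile_sep {t : List Letter} {k : ℕ} (h : t[k]? = some .sep)
    (h' : ∀ j < k, t[j]? ≠ some .sep) : (t.takeWhile (· ≠ .sep)).length = k := by
  induction t generalizing k with
  | nil => simp at h
  | cons a t ih =>
    cases k with
    | zero =>
      obtain rfl : a = .sep := by simpa using h
      simp
    | succ k =>
      have ha : a ≠ .sep := by simpa using h' 0 (Nat.succ_pos k)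
      rw [List.takeWhile_cons_of_pos (by simpa using ha), List.length_cons,
        ih (by simpa using h) fun j hj => by simpa using h' (j + 1) (Nat.succ_lt_succ hj)]

theorem nextField_eq {w : List Letter} {s e : ℕ} (hse : s ≤ e) (h : w[e]? = some .sep)
    (h' : ∀ j, s ≤ j → j < e → w[j]? ≠ some .sep) : nextField w s = e + 1 := by
  have he : e < w.length := (List.getElem?_eq_some_iff.1 h).1
  rw [nextField, length_takeWhile_sep (k := e - s)]
  · omega
  · rwa [List.getElem?_drop, Nat.add_sub_cancel' hse]
  · intro j hj
    rw [List.getElem?_drop]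
    exact h' _ (by omega) (by omega)

theorem nextField_eq_length {w : List Letter} {s : ℕ} (hs : s ≤ w.length)
    (h : ∀ j, s ≤ j → w[j]? ≠ some .sep) : nextField w s = w.length := by
  rw [nextField, List.takeWhile_eq_self_iff.2, List.length_drop]
  · omega
  · intro a ha
    obtain ⟨j, hj⟩ := List.mem_iff_getElem?.1 ha
    rw [List.getElem?_drop] at hj
    simp only [ne_eq, decide_not, Bool.not_eq_eq_eq_not, Bool.not_true, decide_eq_false_iff_not]
    rintro rfl
    exact h _ (Nat.le_add_right _ _) hj

/-! ### First-order definability of reading -/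

section Definability

variable {F : List Letter → (ℕ → ℕ) → ℕ}

theorem fo_noSep {F G : List Letter → (ℕ → ℕ) → ℕ} (hF : FOFun Letter F) (hG : FOFun Letter G) :
    FO fun w v => ∀ j ≤ w.length, F w v ≤ j → j < G w v → w[j]? ≠ some Letter.sep :=
  .all (.imp (.le hF.weak (.var 0)) (.imp (.lt (.var 0) hG.weak) (FO.letter (.var 0) _).not))

theorem foFun_succPos (hF : FOFun Letter F) : FOFun Letter fun w v => succPos w (F w v) where
  le_length _ _ _ := min_le_left _ _
  graph := by
    refine (((FO.lt hF.weak .length).and (FO.add hF.weak (.const 1) (.var 0))).or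
      ((FO.eq hF.weak .length).and (FO.eq (.var 0) .length))).congr fun w v hv => ?_
    have := hF.le_length w _ fun i => hv (i + 1)
    simp only [succPos]
    omega

theorem foFun_nextField (hF : FOFun Letter F) :
    FOFun Letter fun w v => nextField w (F w v) where
  le_length _ _ _ := min_le_left _ _
  graph := by
    refine FO.subst (P := fun w v s => v 0 = nextField w s) ?_ hF.weak
    refine ((FO.ex (P := fun w v e => (v 0 ≤ e ∧ w[e]? = some .sep) ∧
      (∀ j ≤ w.length, v 0 ≤ j → j < e → w[j]? ≠ some .sep) ∧ e + min 1 w.length = v 1) ?_).or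
      ((fo_noSep (.var 0) .length).and (FO.eq (.var 1) .length))).congr fun w v hv => ?_
    · exact ((FO.le (.var 1) (.var 0)).and (FO.letter (.var 0) _)).and
        ((fo_noSep (.var 1) (.var 0)).and (FO.add (.var 0) (.const 1) (.var 2)))
    · change _ ↔ v 1 = nextField w (v 0)
      constructor
      · rintro (⟨e, he, ⟨hse, h⟩, h', h''⟩ | ⟨h, h'⟩)
        · have : e < w.length := (List.getElem?_eq_some_iff.1 h).1
          rw [nextField_eq hse h fun j hj hje => h' j (by omega) hj hje]
          omega
        · rw [nextField_eq_length (hv 0), h']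
          intro j hj hj'
          have hlt : j < w.length := (List.getElem?_eq_some_iff.1 hj').1
          exact h j hlt.le hj hlt hj'
      · intro h
        by_cases hex : ∃ e, v 0 ≤ e ∧ w[e]? = some .sep
        · classical
          have hlt := (List.getElem?_eq_some_iff.1 (Nat.find_spec hex).2).1
          have hmin : ∀ j, v 0 ≤ j → j < Nat.find hex → w[j]? ≠ some .sep :=
            fun j hj hje hj' => Nat.find_min hex hje ⟨hj, hj'⟩
          rw [nextField_eq (Nat.find_spec hex).1 (Nat.find_spec hex).2 hmin] at h
          refine Or.inl ⟨Nat.find hex, hlt.le, Nat.find_spec hex, fun j _ => hmin j, ?_⟩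
          rw [h, min_eq_left (by omega)]
        · push Not at hex
          rw [nextField_eq_length (hv 0) hex] at h
          exact Or.inr ⟨fun j _ hj _ => hex j hj, h⟩

theorem foNum_readNat (hF : FOFun Letter F) :
    FONum Letter fun w v => readNat (w.drop (F w v)) where
  bit := by
    refine (FO.ex (P := fun w v y => F w (fun i => v (i + 1)) + v 0 = y ∧ w[y]? = some .one ∧
      ∀ j ≤ w.length, F w (fun i => v (i + 1)) ≤ j → j < y → w[j]? ≠ some .sep) ?_).congr
      fun w v hv => ?_
    · exact (FO.add hF.weak.weak (.var 1) (.var 0)).and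
        ((FO.letter (.var 0) _).and (fo_noSep hF.weak.weak (.var 0)))
    · rw [testBit_readNat]
      simp only [List.getElem?_drop]
      constructor
      · rintro ⟨y, hy, rfl, h, h'⟩
        exact ⟨h, fun j hj => h' _ (by omega) (by omega) (by omega)⟩
      · rintro ⟨h, h'⟩
        have hlt := (List.getElem?_eq_some_iff.1 h).1
        refine ⟨_, hlt.le, rfl, h, fun j _ hj hj' => ?_⟩
        have := h' (j - F w fun i => v (i + 1)) (by omega)
        rwa [Nat.add_sub_cancel' hj] at this
  high k := (FO.const (0 = k)).congr fun w v _ => by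
    rw [Nat.div_eq_of_lt ((readNat_lt _).trans_le (Nat.pow_le_pow_right two_pos _))]
    simp
  bounded := ⟨0, fun w v _ => by
    rw [Nat.div_eq_of_lt ((readNat_lt _).trans_le (Nat.pow_le_pow_right two_pos _))]
    simp⟩

end Definability

/-! ### Fields -/

/-- The position after `k` further fields. -/
def skipFields (w : List Letter) : ℕ → ℕ → ℕ
  | 0, s => s
  | k + 1, s => skipFields w k (nextField w s)

/-- The `k`-th number of the assertion that begins at the position `p`. -/
def field (w : List Letter) (k p : ℕ) : ℕ := readNat (w.drop (skipFields w k (succPos w p)))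

/-- The position of the `i`-th number in a list of answers that begins at the position `p`. -/
def answerPos (w : List Letter) : ℕ → ℕ → ℕ
  | 0, p => succPos w p
  | i + 1, p => answerPos w i (nextField w (succPos w p))

theorem foFun_skipFields {F : List Letter → (ℕ → ℕ) → ℕ} (hF : FOFun Letter F) (k : ℕ) :
    FOFun Letter fun w v => skipFields w k (F w v) := by
  induction k generalizing F with
  | zero => exact hF
  | succ k ih => exact ih (foFun_nextField hF)

theorem foNum_field {F : List Letter → (ℕ → ℕ) → ℕ} (hF : FOFun Letter F) (k : ℕ) :
    FONum Letter fun w v => field w k (F w v) :=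
  foNum_readNat (foFun_skipFields (foFun_succPos hF) k)

theorem foFun_answerPos {F : List Letter → (ℕ → ℕ) → ℕ} (hF : FOFun Letter F) (i : ℕ) :
    FOFun Letter fun w v => answerPos w i (F w v) := by
  induction i generalizing F with
  | zero => exact foFun_succPos hF
  | succ i ih => exact ih (foFun_nextField (foFun_succPos hF))

theorem drop_succPos {w t : List Letter} {l : Letter} {p : ℕ} (h : w.drop p = l :: t) :
    w.drop (succPos w p) = t := by
  have hp : p < w.length := by
    by_contra hp
    rw [List.drop_eq_nil_of_le (not_lt.1 hp)] at h
    exact List.cons_ne_nil _ _ h.symm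
  rw [succPos, min_eq_right hp, ← List.drop_drop, h]
  rfl

theorem drop_nextField {w r : List Letter} {n s : ℕ} (h : w.drop s = encodeNat n ++ r) :
    w.drop (nextField w s) = r := by
  have hlen := congrArg List.length h
  rw [nextField, h, takeWhile_encodeNat, min_eq_right, add_assoc, ← List.drop_drop, h]
  · exact List.drop_left' (by simp [encodeNat])
  · simp [encodeNat] at hlen ⊢
    omega

theorem readNat_skipFields {w r : List Letter} {s : ℕ} {l : List ℕ}
    (h : w.drop s = l.flatMap encodeNat ++ r) {k : ℕ} (hk : k < l.length) :
    readNat (w.drop (skipFields w k s)) = l[k] := by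
  induction l generalizing s k with
  | nil => simp at hk
  | cons n l ih =>
    rw [List.flatMap_cons, List.append_assoc] at h
    cases k with
    | zero => rw [skipFields, h, readNat_encodeNat]; rfl
    | succ k => exact ih (drop_nextField h) (Nat.lt_of_succ_lt_succ hk)

theorem field_eq {w r : List Letter} {p : ℕ} {a : Letter} {l : List ℕ}
    (h : w.drop p = a :: (l.flatMap encodeNat ++ r)) {k : ℕ} (hk : k < l.length) :
    field w k p = l[k] :=
  readNat_skipFields (drop_succPos h) hk

theorem readNat_answerPos {w r : List Letter} {p : ℕ} {l : List ℕ}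
    (h : w.drop p = (l.flatMap fun c => Letter.answer :: encodeNat c) ++ r) {i : ℕ}
    (hi : i < l.length) : readNat (w.drop (answerPos w i p)) = l[i] := by
  induction l generalizing p i with
  | nil => simp at hi
  | cons n l ih =>
    rw [List.flatMap_cons, List.cons_append, List.cons_append, List.append_assoc] at h
    cases i with
    | zero => rw [answerPos, drop_succPos h, readNat_encodeNat]; rfl
    | succ i => exact ih (drop_nextField (drop_succPos h)) (Nat.lt_of_succ_lt_succ hi)

end FuzzyDL

/-! ### Assertions and their encodings -/

namespace FuzzyDL

/-- The predicate of an assertion: a basic concept or a role name. -/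
abbrev Predicate := BasicConcept ⊕ RoleName

def BasicRole.roleName : BasicRole → ℕ
  | .name P => P
  | .inv P => P

/-- The concept or role name that occurs in a basic concept, as a number. -/
def BasicConcept.number : BasicConcept → ℕ
  | .name A => A
  | .ex Q => Q.roleName

namespace Predicate

/-- The concept or role name that occurs in a predicate, as a number. -/
def number : Predicate → ℕ
  | .inl B => B.number
  | .inr P => P

/-- The letter with which the encoding of an assertion with the given predicate begins. -/
def letter : Predicate → Letter
  | .inl (.name _) => .concept
  | .inl (.ex (.name _)) => .ex
  | .inl (.ex (.inv _)) => .exInv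
  | .inr _ => .role

/-- The field of an assertion that holds its last individual. -/
def lastField : Predicate → ℕ
  | .inl _ => 1
  | .inr _ => 2

theorem eq_of_letter_of_number {π π' : Predicate} (h : letter π = letter π')
    (h' : number π = number π') : π = π' := by
  rcases π with (A | P | P) | P <;> rcases π' with (A' | P' | P') | P' <;>
    simp_all [letter, number, BasicConcept.number, BasicRole.roleName]

instance finite_lt (M : ℕ) : Finite {π : Predicate // number π < M} := by
  have : Finite Letter := inferInstance
  refine Finite.of_injective (β := Letter × Fin M) (fun π => (letter π.1, ⟨number π.1, π.2⟩)) ?_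
  rintro ⟨π, h⟩ ⟨π', h'⟩ hπ
  simp only [Prod.mk.injEq, Fin.mk.injEq] at hπ
  exact Subtype.ext (eq_of_letter_of_number hπ.1 hπ.2)

end Predicate

namespace Assertion

def pred : Assertion → Predicate
  | .concept B _ _ => .inl B
  | .role P _ _ _ => .inr P

def fst : Assertion → IndName
  | .concept _ a _ => a
  | .role _ a _ _ => a

/-- The second individual of a role assertion, and the only individual of a concept assertion. -/
def snd : Assertion → IndName
  | .concept _ a _ => a
  | .role _ _ b _ => b

def deg : Assertion → Degree
  | .concept _ _ d => d
  | .role _ _ _ d => d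

/-- The numbers that follow the initial letter in the encoding of an assertion. -/
def numbers : Assertion → List ℕ
  | .concept B a d => [B.number, a, (d : ℚ).num.toNat, (d : ℚ).den]
  | .role P a b d => [P, a, b, (d : ℚ).num.toNat, (d : ℚ).den]

end Assertion

theorem encodeAssertion_eq (α : Assertion) :
    encodeAssertion α = Predicate.letter α.pred :: α.numbers.flatMap encodeNat := by
  rcases α with ⟨(A | P | P), a, d⟩ | ⟨P, a, b, d⟩ <;>
    simp [encodeAssertion, encodeBasicConcept, encodeDegree, Assertion.numbers, Assertion.pred,
      Predicate.letter, BasicConcept.number, BasicRole.roleName]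

/-- The assertion `α` is written in the word `w` at the position `p`. -/
def WrittenAt (w : List Letter) (p : ℕ) (α : Assertion) : Prop :=
  ∃ r, w.drop p = encodeAssertion α ++ r

namespace WrittenAt

variable {w : List Letter} {p : ℕ} {α : Assertion}

theorem letter_eq (h : WrittenAt w p α) : w[p]? = some (Predicate.letter α.pred) := by
  obtain ⟨r, h⟩ := h
  rw [encodeAssertion_eq] at h
  have := List.getElem?_drop (xs := w) (i := p) (j := 0)
  rw [h] at this
  simpa using this.symm

theorem field_eq_numbers (h : WrittenAt w p α) {k : ℕ} (hk : k < α.numbers.length) :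
    field w k p = α.numbers[k] := by
  obtain ⟨r, h⟩ := h
  rw [encodeAssertion_eq, List.cons_append] at h
  exact field_eq h hk

theorem number_eq (h : WrittenAt w p α) : field w 0 p = Predicate.number α.pred := by
  cases α <;> exact h.field_eq_numbers (k := 0) (by simp [Assertion.numbers])

theorem fst_eq (h : WrittenAt w p α) : field w 1 p = α.fst := by
  cases α <;> exact h.field_eq_numbers (k := 1) (by simp [Assertion.numbers])

theorem snd_eq (h : WrittenAt w p α) : field w (Predicate.lastField α.pred) p = α.snd := by
  cases α
  · exact h.field_eq_numbers (k := 1) (by simp [Assertion.numbers])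
  · exact h.field_eq_numbers (k := 2) (by simp [Assertion.numbers])

theorem num_eq (h : WrittenAt w p α) :
    field w (Predicate.lastField α.pred + 1) p = (α.deg : ℚ).num.toNat := by
  cases α
  · exact h.field_eq_numbers (k := 2) (by simp [Assertion.numbers])
  · exact h.field_eq_numbers (k := 3) (by simp [Assertion.numbers])

theorem den_eq (h : WrittenAt w p α) :
    field w (Predicate.lastField α.pred + 2) p = (α.deg : ℚ).den := by
  cases α
  · exact h.field_eq_numbers (k := 3) (by simp [Assertion.numbers])
  · exact h.field_eq_numbers (k := 4) (by simp [Assertion.numbers])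

end WrittenAt

theorem suffix_append_cases {β : Type*} {s b r : List β} (h : s <:+ b ++ r) :
    s <:+ r ∨ ∃ t, t <:+ b ∧ s = t ++ r := by
  induction b with
  | nil => exact Or.inl h
  | cons x b ih =>
    rw [List.cons_append, List.suffix_cons_iff] at h
    rcases h with rfl | h
    · exact Or.inr ⟨x :: b, List.suffix_rfl, rfl⟩
    · rcases ih h with h | ⟨t, ht, rfl⟩
      · exact Or.inl h
      · exact Or.inr ⟨t, ht.trans (List.suffix_cons _ _), rfl⟩

/-- In a concatenation of blocks, a letter that does not occur inside a block marks the
beginning of one. -/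
theorem exists_block_of_suffix {β : Type*} {S : Set β} {L : List (List β)}
    (hL : ∀ b ∈ L, ∀ x ∈ b.tail, x ∉ S) {x : β} (hx : x ∈ S) {t : List β}
    (h : (x :: t) <:+ L.flatten) : ∃ b ∈ L, ∃ r, x :: t = b ++ r := by
  induction L with
  | nil => simp at h
  | cons b L ih =>
    rw [List.flatten_cons] at h
    rcases suffix_append_cases h with h | ⟨s, hs, hst⟩
    · obtain ⟨b', hb', h⟩ := ih (fun b' hb' => hL b' (List.mem_cons_of_mem _ hb')) h
      exact ⟨b', List.mem_cons_of_mem _ hb', h⟩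
    · cases s with
      | nil =>
        obtain ⟨b', hb', h⟩ := ih (fun b' hb' => hL b' (List.mem_cons_of_mem _ hb'))
          (by rw [hst]; exact List.suffix_rfl)
        exact ⟨b', List.mem_cons_of_mem _ hb', h⟩
      | cons y s =>
        obtain ⟨rfl, rfl⟩ : x = y ∧ t = s ++ L.flatten := by simpa using hst
        cases b with
        | nil => simp at hs
        | cons z b =>
          rcases List.suffix_cons_iff.1 hs with hs | hs
          · exact ⟨z :: b, List.mem_cons_self, L.flatten, by rw [← hs]; rfl⟩
          · exact absurd hx (hL _ List.mem_cons_self x (hs.subset List.mem_cons_self))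

theorem mem_encodeNat {n : ℕ} {l : Letter} (h : l ∈ encodeNat n) :
    l = .zero ∨ l = .one ∨ l = .sep := by
  rw [encodeNat, List.mem_append, List.mem_map, List.mem_singleton] at h
  rcases h with ⟨b, -, rfl⟩ | rfl
  · cases b <;> simp
  · simp

variable {m : ℕ}

theorem exists_writtenAt_of_letter {A : ABox} {a : Fin m → IndName} {p : ℕ} {π : Predicate}
    (h : (encodeData (A, a))[p]? = some (Predicate.letter π)) :
    ∃ α ∈ A, WrittenAt (encodeData (A, a)) p α := by
  set w := encodeData (A, a) with hw
  set L := ((List.ofFn a).map fun c => Letter.answer :: encodeNat c) ++ A.map encodeAssertion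
  have hL : L.flatten = w := by
    simp [L, hw, encodeData, encodeAnswer, List.flatMap_def]
  obtain ⟨hp, hp'⟩ := List.getElem?_eq_some_iff.1 h
  have hd : w.drop p = Predicate.letter π :: w.drop (p + 1) := by
    rw [List.drop_eq_getElem_cons hp, hp']
  have hS : ∀ b ∈ L, ∀ x ∈ b.tail, x ∉ Set.range Predicate.letter := by
    have key : ∀ n, ∀ x ∈ encodeNat n, x ∉ Set.range Predicate.letter := by
      rintro n x hx ⟨π, rfl⟩
      have := mem_encodeNat hx
      rcases π with (A | P | P) | P <;> simp [Predicate.letter] at this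
    intro b hb x hx
    rcases List.mem_append.1 hb with hb | hb
    · obtain ⟨c, -, rfl⟩ := List.mem_map.1 hb
      exact key c x hx
    · obtain ⟨α, -, rfl⟩ := List.mem_map.1 hb
      rw [encodeAssertion_eq, List.tail_cons, List.mem_flatMap] at hx
      obtain ⟨n, -, hn⟩ := hx
      exact key n x hn
  obtain ⟨b, hb, r, hr⟩ := exists_block_of_suffix hS ⟨π, rfl⟩ (t := w.drop (p + 1))
    (by rw [hL, ← hd]; exact List.drop_suffix _ _)
  rcases List.mem_append.1 hb with hb | hb
  · obtain ⟨c, -, rfl⟩ := List.mem_map.1 hb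
    rcases π with (A | P | P) | P <;> simp [Predicate.letter] at hr
  · obtain ⟨α, hα, rfl⟩ := List.mem_map.1 hb
    exact ⟨α, hα, r, hd.trans hr⟩

theorem exists_writtenAt_of_mem {A : ABox} {a : Fin m → IndName} {α : Assertion} (h : α ∈ A) :
    ∃ p ≤ (encodeData (A, a)).length, WrittenAt (encodeData (A, a)) p α := by
  obtain ⟨A₁, A₂, rfl⟩ := List.append_of_mem h
  refine ⟨(encodeAnswer a ++ A₁.flatMap encodeAssertion).length, ?_,
    A₂.flatMap encodeAssertion, ?_⟩
  · simp [encodeData]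
  · have : encodeData (A₁ ++ α :: A₂, a) = (encodeAnswer a ++ A₁.flatMap encodeAssertion) ++
        (encodeAssertion α ++ A₂.flatMap encodeAssertion) := by simp [encodeData]
    rw [this, List.drop_left]

theorem readNat_answer (A : ABox) (a : Fin m → IndName) (i : Fin m) :
    readNat ((encodeData (A, a)).drop (answerPos (encodeData (A, a)) i 0)) = a i := by
  rw [readNat_answerPos (l := List.ofFn a) (r := A.flatMap encodeAssertion) rfl (by simp)]
  simp

end FuzzyDL

/-! ### Gödel semantics: basic facts -/

namespace FuzzyDL

theorem le_godelImp_iff {d u v : ℝ} (hd : d ≤ 1) : d ≤ godelImp u v ↔ min u d ≤ v := by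
  unfold godelImp
  rw [min_le_iff]
  split_ifs with h <;> simp [h, hd]

theorem le_godelImp_godelNeg_iff {d u v : ℝ} (hd : d ≤ 1) (hu : u ≤ 1) :
    d ≤ godelImp u (godelNeg v) ↔ d ≤ 0 ∨ u ≤ 0 ∨ v ≤ 0 := by
  rw [le_godelImp_iff hd, godelNeg, godelImp, min_le_iff]
  split_ifs with h
  · simp [h, hu]
  · simp only [h, or_false]
    exact or_comm

theorem degree_nonneg (d : Degree) : (0 : ℝ) ≤ ((d : ℚ) : ℝ) := by exact_mod_cast d.2.1

theorem degree_le_one (d : Degree) : ((d : ℚ) : ℝ) ≤ 1 := by exact_mod_cast d.2.2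

namespace BasicRole

/-- The role converse to a basic role. -/
def flip : BasicRole → BasicRole
  | name P => inv P
  | inv P => name P

@[simp] theorem flip_flip (Q : BasicRole) : Q.flip.flip = Q := by cases Q <;> rfl

@[simp] theorem roleName_flip (Q : BasicRole) : Q.flip.roleName = Q.roleName := by cases Q <;> rfl

end BasicRole

namespace Interpretation

variable {Δ : Type} (I : Interpretation Δ)

theorem basicRole_flip (Q : BasicRole) (x y : Δ) : I.basicRole Q.flip x y = I.basicRole Q y x := by
  cases Q <;> rfl

theorem basicRole_nonneg (Q : BasicRole) (x y : Δ) : 0 ≤ I.basicRole Q x y := by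
  cases Q <;> exact (I.role _ _ _).2.1

theorem basicRole_le_one (Q : BasicRole) (x y : Δ) : I.basicRole Q x y ≤ 1 := by
  cases Q <;> exact (I.role _ _ _).2.2

theorem bddAbove_basicRole (Q : BasicRole) (x : Δ) :
    BddAbove (Set.range fun y => I.basicRole Q x y) :=
  ⟨1, by rintro _ ⟨y, rfl⟩; exact I.basicRole_le_one Q x y⟩

theorem basicRole_le_ex (Q : BasicRole) (x y : Δ) :
    I.basicRole Q x y ≤ I.basicConcept (.ex Q) x :=
  le_ciSup (I.bddAbove_basicRole Q x) y

theorem basicConcept_nonneg (B : BasicConcept) (x : Δ) : 0 ≤ I.basicConcept B x := by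
  cases B with
  | name A => exact (I.concept A x).2.1
  | ex Q => exact (I.basicRole_nonneg Q x x).trans (I.basicRole_le_ex Q x x)

theorem basicConcept_le_one (B : BasicConcept) (x : Δ) : I.basicConcept B x ≤ 1 := by
  cases B with
  | name A => exact (I.concept A x).2.2
  | ex Q =>
    have : Nonempty Δ := ⟨x⟩
    exact ciSup_le fun y => I.basicRole_le_one Q x y

theorem satAxiom_concept_pos {B B' : BasicConcept} {d : Degree} :
    I.SatAxiom (.concept B (.pos B') d) ↔
      ∀ x, min (I.basicConcept B x) ((d : ℚ) : ℝ) ≤ I.basicConcept B' x :=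
  forall_congr' fun _ => le_godelImp_iff (degree_le_one d)

theorem satAxiom_concept_neg {B B' : BasicConcept} {d : Degree} :
    I.SatAxiom (.concept B (.neg B') d) ↔
      ∀ x, ((d : ℚ) : ℝ) ≤ 0 ∨ I.basicConcept B x ≤ 0 ∨ I.basicConcept B' x ≤ 0 :=
  forall_congr' fun _ => le_godelImp_godelNeg_iff (degree_le_one d) (I.basicConcept_le_one _ _)

theorem satAxiom_role_pos {Q Q' : BasicRole} {d : Degree} :
    I.SatAxiom (.role Q (.pos Q') d) ↔
      ∀ x y, min (I.basicRole Q x y) ((d : ℚ) : ℝ) ≤ I.basicRole Q' x y :=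
  forall₂_congr fun _ _ => le_godelImp_iff (degree_le_one d)

theorem satAxiom_role_neg {Q Q' : BasicRole} {d : Degree} :
    I.SatAxiom (.role Q (.neg Q') d) ↔
      ∀ x y, ((d : ℚ) : ℝ) ≤ 0 ∨ I.basicRole Q x y ≤ 0 ∨ I.basicRole Q' x y ≤ 0 :=
  forall₂_congr fun _ _ => le_godelImp_godelNeg_iff (degree_le_one d) (I.basicRole_le_one _ _ _)

/-- The degree of a predicate at a pair of elements; a concept is read at the first of them. -/
noncomputable def predicate : Predicate → Δ → Δ → ℝ
  | .inl B, x, _ => I.basicConcept B x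
  | .inr P, x, y => I.role P x y

theorem predicate_nonneg (π : Predicate) (x y : Δ) : 0 ≤ I.predicate π x y := by
  rcases π with B | P
  · exact I.basicConcept_nonneg B x
  · exact (I.role P x y).2.1

theorem satAssertion_iff (α : Assertion) : I.SatAssertion α ↔
    ((α.deg : ℚ) : ℝ) ≤ I.predicate α.pred (I.ind α.fst) (I.ind α.snd) := by
  cases α <;> rfl

end Interpretation

namespace ThresholdAtom

variable {m k : ℕ}

def pred : ThresholdAtom m k → Predicate
  | concept B _ _ => .inl B
  | role P _ _ _ => .inr P

def fst : ThresholdAtom m k → Term m k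
  | concept _ t _ => t
  | role _ t _ _ => t

def snd : ThresholdAtom m k → Term m k
  | concept _ t _ => t
  | role _ _ t _ => t

def deg : ThresholdAtom m k → Degree
  | concept _ _ d => d
  | role _ _ _ d => d

theorem sat_iff {Δ : Type} (I : Interpretation Δ) (a : Fin m → IndName) (ρ : Fin k → Δ)
    (γ : ThresholdAtom m k) : γ.Sat I a ρ ↔
      ((γ.deg : ℚ) : ℝ) ≤ I.predicate γ.pred (γ.fst.value I a ρ) (γ.snd.value I a ρ) := by
  cases γ <;> rfl

end ThresholdAtom

/-! ### Degrees of derivability along chains of inclusions -/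

section Chains

open Relation Set

variable {X : Type*}

/-- The best degree of a chain from `x` to `y`, if `S θ` is the relation of being linked by a step
of degree at least `θ`. -/
noncomputable def chainDeg (S : ℝ → X → X → Prop) (x y : X) : ℝ :=
  sSup {θ | θ = 0 ∨ θ ∈ Icc 0 1 ∧ ReflTransGen (S θ) x y}

variable {S : ℝ → X → X → Prop} {x y z : X} {θ : ℝ}

theorem bddAbove_chainDeg : BddAbove {θ | θ = 0 ∨ θ ∈ Icc 0 1 ∧ ReflTransGen (S θ) x y} :=
  ⟨1, by rintro θ (rfl | h); exacts [zero_le_one, h.1.2]⟩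

theorem chainDeg_nonneg : 0 ≤ chainDeg S x y := le_csSup bddAbove_chainDeg (Or.inl rfl)

theorem chainDeg_le_one : chainDeg S x y ≤ 1 :=
  csSup_le ⟨0, Or.inl rfl⟩ (by rintro θ (rfl | h); exacts [zero_le_one, h.1.2])

theorem le_chainDeg (h₀ : 0 ≤ θ) (h₁ : θ ≤ 1) (h : ReflTransGen (S θ) x y) : θ ≤ chainDeg S x y :=
  le_csSup bddAbove_chainDeg (Or.inr ⟨⟨h₀, h₁⟩, h⟩)

theorem chainDeg_self : chainDeg S x x = 1 :=
  le_antisymm chainDeg_le_one (le_chainDeg zero_le_one le_rfl .refl)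

theorem chain_of_lt_chainDeg (hS : ∀ θ θ', θ ≤ θ' → ∀ x y, S θ' x y → S θ x y) (h₀ : 0 ≤ θ)
    (h : θ < chainDeg S x y) : ReflTransGen (S θ) x y := by
  have hne : {θ | θ = 0 ∨ θ ∈ Icc 0 1 ∧ ReflTransGen (S θ) x y}.Nonempty := ⟨0, Or.inl rfl⟩
  obtain ⟨θ', rfl | ⟨-, h'⟩, hlt⟩ := exists_lt_of_lt_csSup hne h
  · exact absurd hlt (not_lt.2 h₀)
  · exact h'.lift id (hS _ _ hlt.le)

theorem min_chainDeg_le (hS : ∀ θ θ', θ ≤ θ' → ∀ x y, S θ' x y → S θ x y) :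
    min (chainDeg S x y) (chainDeg S y z) ≤ chainDeg S x z := by
  by_contra h
  obtain ⟨θ, h₁, h₂⟩ := exists_between (not_le.1 h)
  have h₀ : 0 ≤ θ := chainDeg_nonneg.trans h₁.le
  obtain ⟨hxy, hyz⟩ := lt_min_iff.1 h₂
  exact h₁.not_ge (le_chainDeg h₀ (hxy.le.trans chainDeg_le_one)
    ((chain_of_lt_chainDeg hS h₀ hxy).trans (chain_of_lt_chainDeg hS h₀ hyz)))

theorem chainDeg_le_chainDeg {Y : Type*} {S' : ℝ → Y → Y → Prop} {f : X → Y}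
    (hS : ∀ θ θ', θ ≤ θ' → ∀ x y, S θ' x y → S θ x y)
    (h : ∀ θ x y, S θ x y → S' θ (f x) (f y)) : chainDeg S x y ≤ chainDeg S' (f x) (f y) := by
  by_contra h'
  obtain ⟨θ, h₁, h₂⟩ := exists_between (not_le.1 h')
  have h₀ : 0 ≤ θ := chainDeg_nonneg.trans h₁.le
  exact h₁.not_ge (le_chainDeg h₀ (h₂.le.trans chainDeg_le_one)
    ((chain_of_lt_chainDeg hS h₀ h₂).lift f (h θ)))

theorem min_chainDeg_le_of_step (hS : ∀ θ θ', θ ≤ θ' → ∀ x y, S θ' x y → S θ x y) {g : X → ℝ}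
    (hg₀ : ∀ x, 0 ≤ g x) (hg : ∀ θ x y, S θ x y → min (g x) θ ≤ g y) :
    min (g x) (chainDeg S x y) ≤ g y := by
  by_contra h
  obtain ⟨θ, h₁, h₂⟩ := exists_between (not_le.1 h)
  obtain ⟨hx, hxy⟩ := lt_min_iff.1 h₂
  have hc := chain_of_lt_chainDeg hS ((hg₀ y).trans h₁.le) hxy
  have : ∀ z, ReflTransGen (S θ) x z → θ ≤ g z := by
    intro z hz
    induction hz with
    | refl => exact hx.le
    | tail _ hs ih => exact (le_min ih le_rfl).trans (hg _ _ _ hs)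
  exact h₁.not_ge (this y hc)

end Chains

/-- A step of degree at least `θ` between basic roles: an axiom or its converse. -/
def RoleStep (T : TBox) (θ : ℝ) (Q Q' : BasicRole) : Prop :=
  ∃ d : Degree, θ ≤ ((d : ℚ) : ℝ) ∧
    (TBoxAxiom.role Q (.pos Q') d ∈ T ∨ TBoxAxiom.role Q.flip (.pos Q'.flip) d ∈ T)

/-- A step of degree at least `θ` between basic concepts. Since suprema need not be attained,
`∃Q ⊑ ∃Q'` is a step of its own for each role step from `Q` to `Q'`. -/
def ConceptStep (T : TBox) (θ : ℝ) (B B' : BasicConcept) : Prop :=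
  (∃ d : Degree, θ ≤ ((d : ℚ) : ℝ) ∧ TBoxAxiom.concept B (.pos B') d ∈ T) ∨
    ∃ Q Q', B = .ex Q ∧ B' = .ex Q' ∧ RoleStep T θ Q Q'

section Steps

variable {T : TBox} {θ θ' : ℝ}

theorem RoleStep.anti (T : TBox) (θ θ' : ℝ) (h : θ ≤ θ') (Q Q' : BasicRole)
    (hs : RoleStep T θ' Q Q') : RoleStep T θ Q Q' :=
  hs.imp fun _ => And.imp_left h.trans

theorem ConceptStep.anti (T : TBox) (θ θ' : ℝ) (h : θ ≤ θ') (B B' : BasicConcept)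
    (hs : ConceptStep T θ' B B') : ConceptStep T θ B B' :=
  hs.imp (Exists.imp fun _ => And.imp_left h.trans) fun ⟨Q, Q', h₁, h₂, h₃⟩ =>
    ⟨Q, Q', h₁, h₂, h₃.anti _ _ _ h⟩

theorem RoleStep.flip {Q Q' : BasicRole} (h : RoleStep T θ Q Q') :
    RoleStep T θ Q.flip Q'.flip :=
  h.imp fun _ => And.imp_right fun h => by simpa [or_comm] using h

variable (T) in
/-- The best degree with which an inclusion of basic concepts is derivable. -/
noncomputable abbrev conceptDeg : BasicConcept → BasicConcept → ℝ := chainDeg (ConceptStep T)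

variable (T) in
/-- The best degree with which an inclusion of basic roles is derivable. -/
noncomputable abbrev roleDeg : BasicRole → BasicRole → ℝ := chainDeg (RoleStep T)

theorem min_conceptDeg_le (T : TBox) (B B' B'' : BasicConcept) :
    min (conceptDeg T B B') (conceptDeg T B' B'') ≤ conceptDeg T B B'' :=
  min_chainDeg_le (ConceptStep.anti T)

theorem min_roleDeg_le (T : TBox) (Q Q' Q'' : BasicRole) :
    min (roleDeg T Q Q') (roleDeg T Q' Q'') ≤ roleDeg T Q Q'' :=
  min_chainDeg_le (RoleStep.anti T)

theorem roleDeg_le_flip (T : TBox) (Q Q' : BasicRole) :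
    roleDeg T Q Q' ≤ roleDeg T Q.flip Q'.flip :=
  chainDeg_le_chainDeg (RoleStep.anti T) fun _ _ _ h => h.flip

theorem roleDeg_le_conceptDeg (T : TBox) (Q Q' : BasicRole) :
    roleDeg T Q Q' ≤ conceptDeg T (.ex Q) (.ex Q') :=
  chainDeg_le_chainDeg (RoleStep.anti T) fun _ _ _ h => Or.inr ⟨_, _, rfl, rfl, h⟩

theorem roleDeg_le_conceptDeg_flip (T : TBox) (Q Q' : BasicRole) :
    roleDeg T Q Q' ≤ conceptDeg T (.ex Q.flip) (.ex Q'.flip) :=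
  (roleDeg_le_flip T Q Q').trans (roleDeg_le_conceptDeg T _ _)

variable {Δ : Type} {I : Interpretation Δ}

theorem min_basicRole_le_of_roleStep (hI : ∀ α ∈ T, I.SatAxiom α) {Q Q' : BasicRole}
    (h : RoleStep T θ Q Q') (x y : Δ) : min (I.basicRole Q x y) θ ≤ I.basicRole Q' x y := by
  obtain ⟨d, hd, h | h⟩ := h
  · exact (min_le_min_left _ hd).trans (I.satAxiom_role_pos.1 (hI _ h) x y)
  · have := I.satAxiom_role_pos.1 (hI _ h) y x
    rw [I.basicRole_flip, I.basicRole_flip] at this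
    exact (min_le_min_left _ hd).trans this

theorem min_roleDeg_le_of_model (hI : ∀ α ∈ T, I.SatAxiom α) (Q Q' : BasicRole) (x y : Δ) :
    min (I.basicRole Q x y) (roleDeg T Q Q') ≤ I.basicRole Q' x y :=
  min_chainDeg_le_of_step (g := fun Q => I.basicRole Q x y) (RoleStep.anti T)
    (fun _ => I.basicRole_nonneg _ _ _) fun _ _ _ h => min_basicRole_le_of_roleStep hI h x y

theorem min_conceptDeg_le_of_model (hI : ∀ α ∈ T, I.SatAxiom α) (B B' : BasicConcept) (x : Δ) :
    min (I.basicConcept B x) (conceptDeg T B B') ≤ I.basicConcept B' x := by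
  refine min_chainDeg_le_of_step (g := fun B => I.basicConcept B x) (ConceptStep.anti T)
    (fun _ => I.basicConcept_nonneg _ _) ?_
  rintro θ B B' (⟨d, hd, h⟩ | ⟨Q, Q', rfl, rfl, h⟩)
  · exact (min_le_min_left _ hd).trans (I.satAxiom_concept_pos.1 (hI _ h) x)
  · by_contra hlt
    obtain ⟨h₁, h₂⟩ := lt_min_iff.1 (not_le.1 hlt)
    have : Nonempty Δ := ⟨x⟩
    obtain ⟨y, hy⟩ := exists_lt_of_lt_ciSup h₁
    exact ((lt_min hy h₂).trans_le (min_basicRole_le_of_roleStep hI h x y)).not_ge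
      (I.basicRole_le_ex Q' x y)

end Steps

end FuzzyDL

/-! ### The canonical model -/

namespace FuzzyDL

open Filter Topology

/-- The elements of the canonical model: the individuals and, for each element `x`, each basic
role `Q` and each `n`, an anonymous `Q`-successor of `x`. Since a model need not have a successor
that attains the degree of `∃Q` at `x`, the `n`-th one only gets the degree of `∃Q` at `x` times
`approx n`. -/
inductive CanonicalDomain where
  | ind (a : IndName)
  | succ (Q : BasicRole) (n : ℕ) (x : CanonicalDomain)

/-- A sequence in `[0, 1)` that converges to `1`. -/
noncomputable def approx (n : ℕ) : ℝ := 1 - 1 / ((n : ℝ) + 1)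

theorem approx_nonneg (n : ℕ) : 0 ≤ approx n := by
  rw [approx, sub_nonneg, div_le_one (by positivity)]
  linarith [n.cast_nonneg (α := ℝ)]

theorem approx_lt_one (n : ℕ) : approx n < 1 := by
  rw [approx, sub_lt_self_iff]
  positivity

theorem tendsto_approx : Tendsto approx atTop (𝓝 1) := by
  have h := (tendsto_const_nhds (x := (1 : ℝ))).sub
    (tendsto_one_div_add_atTop_nhds_zero_nat (𝕜 := ℝ))
  rwa [sub_zero] at h

/-! ### The part that is derived from a single assertion -/

section Single

variable (T : TBox) (α : Assertion)

open Classical in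
/-- The degree of the basic concept `B` at the individual `a` that the assertion `α` entails. -/
noncomputable def baseDeg (a : IndName) (B : BasicConcept) : ℝ :=
  match α with
  | .concept B' a' d => if a' = a then min ((d : ℚ) : ℝ) (conceptDeg T B' B) else 0
  | .role P b c d =>
    max (if b = a then min ((d : ℚ) : ℝ) (conceptDeg T (.ex (.name P)) B) else 0)
      (if c = a then min ((d : ℚ) : ℝ) (conceptDeg T (.ex (.inv P)) B) else 0)

/-- The degree of a basic concept at an element that is derived from `α`. At an anonymous successor
everything comes from the edge that leads to it. -/
noncomputable def canonicalConcept : CanonicalDomain → BasicConcept → ℝ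
  | .ind a, B => baseDeg T α a B
  | .succ Q n x, B => min (approx n * canonicalConcept x (.ex Q)) (conceptDeg T (.ex Q.flip) B)

open Classical in
/-- The degree of a basic role that is due to an asserted pair or to an anonymous successor, in
the direction of the assertion or of the successor. -/
noncomputable def edgeDeg : CanonicalDomain → CanonicalDomain → BasicRole → ℝ
  | .ind a, .ind b, Q =>
    match α with
    | .concept _ _ _ => 0
    | .role P a' b' d =>
      if a' = a ∧ b' = b then min ((d : ℚ) : ℝ) (roleDeg T (.name P) Q) else 0
  | x, .succ Q' n x', Q =>
    if x' = x then min (approx n * canonicalConcept T α x' (.ex Q')) (roleDeg T Q' Q) else 0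
  | .succ _ _ _, .ind _, _ => 0

/-- The degree of a basic role at a pair of elements that is derived from `α`. -/
noncomputable def canonicalRole (x y : CanonicalDomain) (Q : BasicRole) : ℝ :=
  max (edgeDeg T α x y Q) (edgeDeg T α y x Q.flip)

variable {T α}

theorem baseDeg_nonneg (a : IndName) (B : BasicConcept) : 0 ≤ baseDeg T α a B := by
  cases α with
  | concept B' a' d =>
    simp only [baseDeg]
    split_ifs
    exacts [le_min (degree_nonneg d) chainDeg_nonneg, le_rfl]
  | role P b c d =>
    simp only [baseDeg]
    refine le_max_of_le_left ?_
    split_ifs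
    exacts [le_min (degree_nonneg d) chainDeg_nonneg, le_rfl]

theorem baseDeg_le_one (a : IndName) (B : BasicConcept) : baseDeg T α a B ≤ 1 := by
  have h : ∀ (p : Prop) [Decidable p] (d : Degree) (r : ℝ),
      (if p then min ((d : ℚ) : ℝ) r else 0) ≤ 1 := by
    intro p _ d r
    split_ifs
    exacts [min_le_of_left_le (degree_le_one d), zero_le_one]
  cases α with
  | concept B' a' d => exact h _ _ _
  | role P b c d => exact max_le (h _ _ _) (h _ _ _)

theorem canonicalConcept_nonneg (x : CanonicalDomain) (B : BasicConcept) :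
    0 ≤ canonicalConcept T α x B := by
  induction x generalizing B with
  | ind a => exact baseDeg_nonneg a B
  | succ Q n x ih => exact le_min (mul_nonneg (approx_nonneg n) (ih _)) chainDeg_nonneg

theorem canonicalConcept_le_one (x : CanonicalDomain) (B : BasicConcept) :
    canonicalConcept T α x B ≤ 1 := by
  cases x with
  | ind a => exact baseDeg_le_one a B
  | succ Q n x => exact min_le_of_right_le chainDeg_le_one

theorem approx_mul_le (n : ℕ) (x : CanonicalDomain) (B : BasicConcept) :
    approx n * canonicalConcept T α x B ≤ canonicalConcept T α x B :=
  mul_le_of_le_one_left (canonicalConcept_nonneg x B) (approx_lt_one n).le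

theorem edgeDeg_succ (x x' : CanonicalDomain) (Q Q' : BasicRole) (n : ℕ) [Decidable (x' = x)] :
    edgeDeg T α x (.succ Q' n x') Q = if x' = x then
      min (approx n * canonicalConcept T α x' (.ex Q')) (roleDeg T Q' Q) else 0 := by
  cases x <;> simp only [edgeDeg] <;> congr

theorem min_baseDeg_le (a : IndName) (B B' : BasicConcept) :
    min (baseDeg T α a B) (conceptDeg T B B') ≤ baseDeg T α a B' := by
  have h : ∀ (p : Prop) [Decidable p] (d : Degree) (B₀ : BasicConcept),
      min (if p then min ((d : ℚ) : ℝ) (conceptDeg T B₀ B) else 0) (conceptDeg T B B') ≤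
        if p then min ((d : ℚ) : ℝ) (conceptDeg T B₀ B') else 0 := by
    intro p _ d B₀
    split_ifs
    · rw [min_assoc]
      exact min_le_min_left _ (min_conceptDeg_le T _ _ _)
    · exact min_le_left _ _
  cases α with
  | concept B₀ a' d => exact h _ _ _
  | role P b c d =>
    simp only [baseDeg]
    rw [min_max_distrib_right]
    exact max_le_max (h _ _ _) (h _ _ _)

theorem min_canonicalConcept_le (x : CanonicalDomain) (B B' : BasicConcept) :
    min (canonicalConcept T α x B) (conceptDeg T B B') ≤ canonicalConcept T α x B' := by
  cases x with
  | ind a => exact min_baseDeg_le a B B'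
  | succ Q n x =>
    simp only [canonicalConcept]
    rw [min_assoc]
    exact min_le_min_left _ (min_conceptDeg_le T _ _ _)

theorem min_edgeDeg_le (x y : CanonicalDomain) (Q Q' : BasicRole) :
    min (edgeDeg T α x y Q) (roleDeg T Q Q') ≤ edgeDeg T α x y Q' := by
  classical
  cases y with
  | ind b =>
    cases x with
    | ind a =>
      cases α with
      | concept => exact min_le_left _ _
      | role P c d e =>
        simp only [edgeDeg]
        split_ifs
        · rw [min_assoc]
          exact min_le_min_left _ (min_roleDeg_le T _ _ _)
        · exact min_le_left _ _
    | succ => exact min_le_left _ _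
  | succ Q₀ n x' =>
    rw [edgeDeg_succ, edgeDeg_succ]
    split_ifs
    · rw [min_assoc]
      exact min_le_min_left _ (min_roleDeg_le T _ _ _)
    · exact min_le_left _ _

theorem min_canonicalRole_le (x y : CanonicalDomain) (Q Q' : BasicRole) :
    min (canonicalRole T α x y Q) (roleDeg T Q Q') ≤ canonicalRole T α x y Q' := by
  rw [canonicalRole, min_max_distrib_right]
  exact max_le_max (min_edgeDeg_le x y Q Q')
    ((min_le_min_left _ (roleDeg_le_flip T Q Q')).trans (min_edgeDeg_le y x Q.flip Q'.flip))

theorem edgeDeg_le_fst (x y : CanonicalDomain) (Q : BasicRole) :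
    edgeDeg T α x y Q ≤ canonicalConcept T α x (.ex Q) := by
  classical
  cases y with
  | ind b =>
    cases x with
    | ind a =>
      cases α with
      | concept => exact baseDeg_nonneg _ _
      | role P c d e =>
        rw [edgeDeg]
        split_ifs with h
        · simp only [canonicalConcept, baseDeg]
          rw [if_pos h.1]
          exact le_max_of_le_left (min_le_min_left _ (roleDeg_le_conceptDeg T _ _))
        · exact baseDeg_nonneg _ _
    | succ Q' n x => exact canonicalConcept_nonneg _ _
  | succ Q' n x' =>
    rw [edgeDeg_succ]
    split_ifs with h
    · subst h
      exact (min_le_min (approx_mul_le n x' _) (roleDeg_le_conceptDeg T _ _)).trans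
        (min_canonicalConcept_le x' _ _)
    · exact canonicalConcept_nonneg _ _

theorem edgeDeg_le_snd (x y : CanonicalDomain) (Q : BasicRole) :
    edgeDeg T α x y Q ≤ canonicalConcept T α y (.ex Q.flip) := by
  classical
  cases y with
  | ind b =>
    cases x with
    | ind a =>
      cases α with
      | concept => exact baseDeg_nonneg _ _
      | role P c d e =>
        rw [edgeDeg]
        split_ifs with h
        · simp only [canonicalConcept, baseDeg]
          rw [if_pos h.2]
          exact le_max_of_le_right (min_le_min_left _ (roleDeg_le_conceptDeg_flip T _ _))
        · exact baseDeg_nonneg _ _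
    | succ Q' n x => exact canonicalConcept_nonneg _ _
  | succ Q' n x' =>
    rw [edgeDeg_succ]
    split_ifs with h
    · exact min_le_min_left _ (roleDeg_le_conceptDeg_flip T _ _)
    · exact canonicalConcept_nonneg _ _

/-- The successors do not raise the degree of `∃Q` above the derived one; here role inclusions have
to count as inclusions between existential concepts. -/
theorem canonicalRole_le_ex (x y : CanonicalDomain) (Q : BasicRole) :
    canonicalRole T α x y Q ≤ canonicalConcept T α x (.ex Q) := by
  refine max_le (edgeDeg_le_fst x y Q) ?_
  simpa using edgeDeg_le_snd (T := T) (α := α) y x Q.flip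

theorem canonicalRole_le_one (x y : CanonicalDomain) (Q : BasicRole) :
    canonicalRole T α x y Q ≤ 1 :=
  (canonicalRole_le_ex x y Q).trans (canonicalConcept_le_one x _)

theorem canonicalRole_flip (x y : CanonicalDomain) (Q : BasicRole) :
    canonicalRole T α x y Q.flip = canonicalRole T α y x Q := by
  rw [canonicalRole, canonicalRole, BasicRole.flip_flip, max_comm]

theorem approx_mul_le_canonicalRole (n : ℕ) (x : CanonicalDomain) (Q : BasicRole) :
    approx n * canonicalConcept T α x (.ex Q) ≤ canonicalRole T α x (.succ Q n x) Q := by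
  classical
  refine le_max_of_le_left ?_
  rw [edgeDeg_succ, if_pos rfl, roleDeg, chainDeg_self]
  exact le_min le_rfl ((approx_mul_le n x _).trans (canonicalConcept_le_one x _))

variable (T α) in
/-- The degree of a predicate at a pair of elements, as `Interpretation.predicate`. -/
noncomputable def canonicalPredicate : Predicate → CanonicalDomain → CanonicalDomain → ℝ
  | .inl B, x, _ => canonicalConcept T α x B
  | .inr P, x, y => canonicalRole T α x y (.name P)

theorem deg_le_canonicalPredicate :
    ((α.deg : ℚ) : ℝ) ≤ canonicalPredicate T α α.pred (.ind α.fst) (.ind α.snd) := by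
  cases α with
  | concept B a d =>
    simp only [canonicalPredicate, Assertion.pred, canonicalConcept, baseDeg, Assertion.fst,
      Assertion.deg, if_true]
    rw [conceptDeg, chainDeg_self]
    exact le_min le_rfl (degree_le_one d)
  | role P a b d =>
    simp only [canonicalPredicate, Assertion.pred, canonicalRole, edgeDeg, Assertion.fst,
      Assertion.deg, Assertion.snd, and_self, if_true]
    rw [roleDeg, chainDeg_self]
    exact le_max_of_le_left (le_min le_rfl (degree_le_one d))

/-! ### Universality -/

section Universal

variable {Δ : Type} (J : Interpretation Δ)

theorem exists_approx_successor (Q : BasicRole) (n : ℕ) (x : Δ) :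
    ∃ y, approx n * J.basicConcept (.ex Q) x ≤ J.basicRole Q x y := by
  rcases (J.basicConcept_nonneg (.ex Q) x).eq_or_lt with h | h
  · exact ⟨x, by rw [← h, mul_zero]; exact J.basicRole_nonneg _ _ _⟩
  · have : Nonempty Δ := ⟨x⟩
    have hlt : approx n * J.basicConcept (.ex Q) x < ⨆ y, J.basicRole Q x y :=
      mul_lt_of_lt_one_left h (approx_lt_one n)
    obtain ⟨y, hy⟩ := exists_lt_of_lt_ciSup hlt
    exact ⟨y, hy.le⟩

/-- The homomorphism from the canonical model to a model. -/
noncomputable def canonicalHom : CanonicalDomain → Δ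
  | .ind a => J.ind a
  | .succ Q n x => (exists_approx_successor J Q n (canonicalHom x)).choose

theorem approx_mul_le_canonicalHom (Q : BasicRole) (n : ℕ) (x : CanonicalDomain) :
    approx n * J.basicConcept (.ex Q) (canonicalHom J x) ≤
      J.basicRole Q (canonicalHom J x) (canonicalHom J (.succ Q n x)) :=
  (exists_approx_successor J Q n (canonicalHom J x)).choose_spec

variable {J}

theorem baseDeg_le_model (hJ : ∀ β ∈ T, J.SatAxiom β) (hα : J.SatAssertion α) (a : IndName)
    (B : BasicConcept) : baseDeg T α a B ≤ J.basicConcept B (J.ind a) := by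
  have h : ∀ (p : Prop) [Decidable p] (d : Degree) (B₀ : BasicConcept),
      (p → ((d : ℚ) : ℝ) ≤ J.basicConcept B₀ (J.ind a)) →
      (if p then min ((d : ℚ) : ℝ) (conceptDeg T B₀ B) else 0) ≤ J.basicConcept B (J.ind a) := by
    intro p _ d B₀ h
    split_ifs with hp
    · exact (min_le_min_right _ (h hp)).trans (min_conceptDeg_le_of_model hJ _ _ _)
    · exact J.basicConcept_nonneg _ _
  cases α with
  | concept B₀ a' d => exact h _ _ _ fun hp => hp ▸ hα
  | role P b c d =>
    refine max_le (h _ _ _ fun hp => ?_) (h _ _ _ fun hp => ?_)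
    · subst hp
      exact le_trans hα (J.basicRole_le_ex (.name P) _ (J.ind c))
    · subst hp
      exact le_trans hα (J.basicRole_le_ex (.inv P) _ (J.ind b))

theorem canonicalConcept_le_model (hJ : ∀ β ∈ T, J.SatAxiom β) (hα : J.SatAssertion α)
    (x : CanonicalDomain) (B : BasicConcept) :
    canonicalConcept T α x B ≤ J.basicConcept B (canonicalHom J x) := by
  induction x generalizing B with
  | ind a => exact baseDeg_le_model hJ hα a B
  | succ Q n x ih =>
    have h₁ := (mul_le_mul_of_nonneg_left (ih (.ex Q)) (approx_nonneg n)).trans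
      (approx_mul_le_canonicalHom J Q n x)
    rw [← J.basicRole_flip] at h₁
    exact (min_le_min_right _ (h₁.trans (J.basicRole_le_ex _ _ _))).trans
      (min_conceptDeg_le_of_model hJ _ _ _)

theorem edgeDeg_le_model (hJ : ∀ β ∈ T, J.SatAxiom β) (hα : J.SatAssertion α)
    (x y : CanonicalDomain) (Q : BasicRole) :
    edgeDeg T α x y Q ≤ J.basicRole Q (canonicalHom J x) (canonicalHom J y) := by
  classical
  cases y with
  | ind b =>
    cases x with
    | ind a =>
      cases α with
      | concept => exact J.basicRole_nonneg _ _ _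
      | role P c d e =>
        simp only [edgeDeg]
        split_ifs with h
        · obtain ⟨rfl, rfl⟩ := h
          exact (min_le_min_right _ hα).trans (min_roleDeg_le_of_model hJ (.name P) Q _ _)
        · exact J.basicRole_nonneg _ _ _
    | succ => exact J.basicRole_nonneg _ _ _
  | succ Q' n x' =>
    rw [edgeDeg_succ]
    split_ifs with h
    · subst h
      exact (min_le_min_right _ ((mul_le_mul_of_nonneg_left
        (canonicalConcept_le_model hJ hα x' _) (approx_nonneg n)).trans
        (approx_mul_le_canonicalHom J Q' n x'))).trans (min_roleDeg_le_of_model hJ _ _ _ _)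
    · exact J.basicRole_nonneg _ _ _

theorem canonicalRole_le_model (hJ : ∀ β ∈ T, J.SatAxiom β) (hα : J.SatAssertion α)
    (x y : CanonicalDomain) (Q : BasicRole) :
    canonicalRole T α x y Q ≤ J.basicRole Q (canonicalHom J x) (canonicalHom J y) := by
  refine max_le (edgeDeg_le_model hJ hα x y Q) ?_
  rw [← J.basicRole_flip]
  exact edgeDeg_le_model hJ hα y x Q.flip

theorem canonicalPredicate_le_model (hJ : ∀ β ∈ T, J.SatAxiom β) (hα : J.SatAssertion α)
    (π : Predicate) (x y : CanonicalDomain) :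
    canonicalPredicate T α π x y ≤ J.predicate π (canonicalHom J x) (canonicalHom J y) := by
  rcases π with B | P
  · exact canonicalConcept_le_model hJ hα x B
  · exact canonicalRole_le_model hJ hα x y (.name P)

end Universal

end Single

end FuzzyDL

namespace FuzzyDL

open Filter Topology

/-! ### Joining the parts of all assertions -/

/-- The maximum of `0` and the values of `f` on an ABox. -/
noncomputable def maxOver (A : ABox) (f : Assertion → ℝ) : ℝ := (A.map f).foldr max 0

section MaxOver

variable {A : ABox} {f g : Assertion → ℝ}

theorem maxOver_nonneg : 0 ≤ maxOver A f := by
  induction A with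
  | nil => exact le_rfl
  | cons α A ih => exact le_max_of_le_right ih

theorem le_maxOver {α : Assertion} (h : α ∈ A) : f α ≤ maxOver A f := by
  induction A with
  | nil => simp at h
  | cons β A ih =>
    rcases List.mem_cons.1 h with rfl | h
    · exact le_max_left _ _
    · exact le_max_of_le_right (ih h)

theorem maxOver_le {c : ℝ} (hc : 0 ≤ c) (h : ∀ α ∈ A, f α ≤ c) : maxOver A f ≤ c := by
  induction A with
  | nil => exact hc
  | cons α A ih =>
    exact max_le (h α List.mem_cons_self) (ih fun β hβ => h β (List.mem_cons_of_mem _ hβ))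

theorem exists_le_of_le_maxOver {c : ℝ} (hc : 0 < c) (h : c ≤ maxOver A f) :
    ∃ α ∈ A, c ≤ f α := by
  by_contra hcon
  push Not at hcon
  induction A with
  | nil => exact hc.not_ge h
  | cons α A ih =>
    rcases le_max_iff.1 h with h | h
    · exact (hcon α List.mem_cons_self).not_ge h
    · exact ih h fun β hβ => hcon β (List.mem_cons_of_mem _ hβ)

theorem min_maxOver_le {c : ℝ} (h : ∀ α ∈ A, min (f α) c ≤ g α) :
    min (maxOver A f) c ≤ maxOver A g := by
  by_contra hcon
  obtain ⟨h₁, h₂⟩ := lt_min_iff.1 (not_le.1 hcon)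
  obtain ⟨α, hα, h'⟩ := exists_le_of_le_maxOver (maxOver_nonneg.trans_lt h₁) le_rfl
  exact ((lt_min (h₁.trans_le h') h₂).trans_le (h α hα)).not_ge (le_maxOver hα)

end MaxOver

/-- The canonical model of an ontology: the join of the parts derived from single assertions. -/
noncomputable def canonicalModel (T : TBox) (A : ABox) : Interpretation CanonicalDomain where
  ind := .ind
  concept N x := ⟨maxOver A fun α => canonicalConcept T α x (.name N), maxOver_nonneg,
    maxOver_le zero_le_one fun _ _ => canonicalConcept_le_one _ _⟩
  role P x y := ⟨maxOver A fun α => canonicalRole T α x y (.name P), maxOver_nonneg,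
    maxOver_le zero_le_one fun _ _ => canonicalRole_le_one _ _ _⟩

section CanonicalModel

variable {T : TBox} {A : ABox}

theorem canonicalModel_basicRole (Q : BasicRole) (x y : CanonicalDomain) :
    (canonicalModel T A).basicRole Q x y = maxOver A fun α => canonicalRole T α x y Q := by
  cases Q with
  | name P => rfl
  | inv P =>
    have h : ∀ α, canonicalRole T α x y (.inv P) = canonicalRole T α y x (.name P) :=
      fun α => canonicalRole_flip x y (.name P)
    simp only [h]
    rfl

/-- In the canonical model the suprema over anonymous successors have the derived degrees. -/
theorem canonicalModel_basicConcept (B : BasicConcept) (x : CanonicalDomain) :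
    (canonicalModel T A).basicConcept B x = maxOver A fun α => canonicalConcept T α x B := by
  cases B with
  | name N => rfl
  | ex Q =>
    have : Nonempty CanonicalDomain := ⟨x⟩
    apply le_antisymm
    · refine ciSup_le fun y => ?_
      rw [canonicalModel_basicRole]
      exact maxOver_le maxOver_nonneg fun α hα => (canonicalRole_le_ex x y Q).trans
        (le_maxOver (f := fun α => canonicalConcept T α x (.ex Q)) hα)
    · refine maxOver_le ((canonicalModel T A).basicConcept_nonneg _ _) fun α hα => ?_
      have hlim : Tendsto (fun n => approx n * canonicalConcept T α x (.ex Q)) atTop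
          (𝓝 (canonicalConcept T α x (.ex Q))) := by
        simpa using tendsto_approx.mul_const (canonicalConcept T α x (.ex Q))
      refine le_of_tendsto' hlim fun n => (approx_mul_le_canonicalRole n x Q).trans ?_
      refine le_trans ?_ ((canonicalModel T A).basicRole_le_ex Q x (.succ Q n x))
      rw [canonicalModel_basicRole]
      exact le_maxOver (f := fun α => canonicalRole T α x (.succ Q n x) Q) hα

theorem canonicalModel_predicate (π : Predicate) (x y : CanonicalDomain) :
    (canonicalModel T A).predicate π x y = maxOver A fun α => canonicalPredicate T α π x y := by
  rcases π with B | P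
  · exact canonicalModel_basicConcept B x
  · rfl

theorem conceptDeg_of_axiom {B B' : BasicConcept} {d : Degree}
    (h : TBoxAxiom.concept B (.pos B') d ∈ T) : ((d : ℚ) : ℝ) ≤ conceptDeg T B B' :=
  le_chainDeg (degree_nonneg d) (degree_le_one d) (.single (Or.inl ⟨d, le_rfl, h⟩))

theorem roleDeg_of_axiom {Q Q' : BasicRole} {d : Degree}
    (h : TBoxAxiom.role Q (.pos Q') d ∈ T) : ((d : ℚ) : ℝ) ≤ roleDeg T Q Q' :=
  le_chainDeg (degree_nonneg d) (degree_le_one d) (.single ⟨d, le_rfl, Or.inl h⟩)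

/-- The positive axioms hold by construction, the negative ones because the canonical model maps
homomorphically to a model. -/
theorem canonicalModel_isModel (h : (Ontology.mk T A).Consistent) :
    (canonicalModel T A).IsModel ⟨T, A⟩ := by
  obtain ⟨Δ, J, hJ, hA⟩ := h
  have hconcept : ∀ B x, (canonicalModel T A).basicConcept B x ≤
      J.basicConcept B (canonicalHom J x) := fun B x => by
    rw [canonicalModel_basicConcept]
    exact maxOver_le (J.basicConcept_nonneg _ _) fun α hα =>
      canonicalConcept_le_model hJ (hA α hα) x B
  have hrole : ∀ Q x y, (canonicalModel T A).basicRole Q x y ≤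
      J.basicRole Q (canonicalHom J x) (canonicalHom J y) := fun Q x y => by
    rw [canonicalModel_basicRole]
    exact maxOver_le (J.basicRole_nonneg _ _ _) fun α hα =>
      canonicalRole_le_model hJ (hA α hα) x y Q
  refine ⟨fun β hβ => ?_, fun α hα => ?_⟩
  · have hβJ := hJ β hβ
    rcases β with ⟨B, B' | B', d⟩ | ⟨Q, Q' | Q', d⟩
    · rw [Interpretation.satAxiom_concept_pos]
      intro x
      rw [canonicalModel_basicConcept, canonicalModel_basicConcept]
      exact min_maxOver_le fun α _ => (min_le_min_left _ (conceptDeg_of_axiom hβ)).trans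
        (min_canonicalConcept_le x B B')
    · rw [Interpretation.satAxiom_concept_neg] at hβJ ⊢
      exact fun x => (hβJ (canonicalHom J x)).imp_right
        (Or.imp (hconcept B x).trans (hconcept B' x).trans)
    · rw [Interpretation.satAxiom_role_pos]
      intro x y
      rw [canonicalModel_basicRole, canonicalModel_basicRole]
      exact min_maxOver_le fun α _ => (min_le_min_left _ (roleDeg_of_axiom hβ)).trans
        (min_canonicalRole_le x y Q Q')
    · rw [Interpretation.satAxiom_role_neg] at hβJ ⊢
      exact fun x y => (hβJ (canonicalHom J x) (canonicalHom J y)).imp_right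
        (Or.imp (hrole Q x y).trans (hrole Q' x y).trans)
  · rw [Interpretation.satAssertion_iff, canonicalModel_predicate]
    exact deg_le_canonicalPredicate.trans (le_maxOver
      (f := fun β => canonicalPredicate T β α.pred (.ind α.fst) (.ind α.snd)) hα)

end CanonicalModel

/-! ### Relevant names -/

/-- The name on the left-hand side of an axiom, as a number. -/
def TBoxAxiom.lhsNumber : TBoxAxiom → ℕ
  | .concept B _ _ => B.number
  | .role Q _ _ => Q.roleName

section Relevance

variable {T : TBox} {M : ℕ} {α : Assertion}

theorem number_lt_of_conceptDeg_pos (hM : ∀ β ∈ T, β.lhsNumber < M) {B B' : BasicConcept}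
    (h : 0 < conceptDeg T B B') (hB' : B'.number < M) : B.number < M := by
  rcases (chain_of_lt_chainDeg (ConceptStep.anti T) le_rfl h).cases_head with rfl | ⟨B₁, hs, -⟩
  · exact hB'
  · rcases hs with ⟨d, -, h⟩ | ⟨Q, Q', rfl, -, d, -, h | h⟩
    · exact hM _ h
    · exact hM _ h
    · simpa [TBoxAxiom.lhsNumber, BasicConcept.number] using hM _ h

theorem number_lt_of_baseDeg_pos (hM : ∀ β ∈ T, β.lhsNumber < M) {a : IndName} {B : BasicConcept}
    (h : 0 < baseDeg T α a B) (hB : B.number < M) : Predicate.number α.pred < M := by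
  have key : ∀ (p : Prop) [Decidable p] (d : Degree) (B₀ : BasicConcept),
      0 < (if p then min ((d : ℚ) : ℝ) (conceptDeg T B₀ B) else 0) → B₀.number < M := by
    intro p _ d B₀ h
    split_ifs at h
    · exact number_lt_of_conceptDeg_pos hM (lt_min_iff.1 h).2 hB
    · exact absurd h (lt_irrefl _)
  cases α with
  | concept B₀ a' d => exact key _ _ _ h
  | role P b c d =>
    rcases lt_max_iff.1 h with h | h
    · exact key _ _ (.ex (.name P)) h
    · exact key _ _ (.ex (.inv P)) h

theorem number_lt_of_canonicalConcept_pos (hM : ∀ β ∈ T, β.lhsNumber < M) {x : CanonicalDomain}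
    {B : BasicConcept} (h : 0 < canonicalConcept T α x B) (hB : B.number < M) :
    Predicate.number α.pred < M := by
  induction x generalizing B with
  | ind a => exact number_lt_of_baseDeg_pos hM h hB
  | succ Q n x ih =>
    obtain ⟨h₁, h₂⟩ := lt_min_iff.1 h
    refine ih (h₁.trans_le (approx_mul_le n x _)) ?_
    have := number_lt_of_conceptDeg_pos hM h₂ hB
    rwa [BasicConcept.number, BasicRole.roleName_flip] at this

theorem number_lt_of_canonicalPredicate_pos (hM : ∀ β ∈ T, β.lhsNumber < M)
    {x y : CanonicalDomain} {π : Predicate} (h : 0 < canonicalPredicate T α π x y)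
    (hπ : Predicate.number π < M) : Predicate.number α.pred < M := by
  rcases π with B | P
  · exact number_lt_of_canonicalConcept_pos hM h hπ
  · exact number_lt_of_canonicalConcept_pos hM
      (B := .ex (.name P)) (h.trans_le (canonicalRole_le_ex x y (.name P))) hπ

end Relevance

/-! ### Locality of certain answers -/

variable {m : ℕ}

/-- The atoms of a query whose threshold is positive; the others hold everywhere. -/
def ThresholdQuery.posAtoms (q : ThresholdQuery m) : List (ThresholdAtom m q.numEx) :=
  q.atoms.filter fun γ => decide (0 < (γ.deg : ℚ))

/-- A certain answer is supported by one relevant assertion for each atom of positive threshold,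
because every degree in the canonical model is derived from a single assertion. -/
theorem exists_support {T : TBox} {A : ABox} {q : ThresholdQuery m} {a : Fin m → IndName} {M : ℕ}
    (hT : ∀ β ∈ T, β.lhsNumber < M) (hq : ∀ γ ∈ q.atoms, Predicate.number γ.pred < M)
    (hcons : (Ontology.mk T A).Consistent) (h : q.IsCertainAnswer ⟨T, A⟩ a) :
    ∃ α : Fin q.posAtoms.length → Assertion,
      (∀ j, α j ∈ A ∧ Predicate.number (α j).pred < M) ∧
        q.IsCertainAnswer ⟨T, List.ofFn α⟩ a := by
  obtain ⟨ρ, hρ⟩ := h _ _ (canonicalModel_isModel hcons)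
  have hatom : ∀ j : Fin q.posAtoms.length, ∃ α ∈ A,
      (((q.posAtoms.get j).deg : ℚ) : ℝ) ≤ canonicalPredicate T α (q.posAtoms.get j).pred
        ((q.posAtoms.get j).fst.value (canonicalModel T A) a ρ)
        ((q.posAtoms.get j).snd.value (canonicalModel T A) a ρ) ∧
      Predicate.number α.pred < M := by
    intro j
    obtain ⟨hmem, hpos⟩ := List.mem_filter.1 (List.get_mem q.posAtoms j)
    have hpos' : (0 : ℝ) < (((q.posAtoms.get j).deg : ℚ) : ℝ) := by
      exact_mod_cast of_decide_eq_true hpos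
    have hsat := (ThresholdAtom.sat_iff _ _ _ _).1 (hρ _ hmem)
    rw [canonicalModel_predicate] at hsat
    obtain ⟨α, hα, hle⟩ := exists_le_of_le_maxOver hpos' hsat
    exact ⟨α, hα, hle, number_lt_of_canonicalPredicate_pos hT (hpos'.trans_le hle) (hq _ hmem)⟩
  choose α hαA hαle hαM using hatom
  refine ⟨α, fun j => ⟨hαA j, hαM j⟩, fun Δ J hJ => ⟨fun i => canonicalHom J (ρ i), ?_⟩⟩
  intro γ hγ
  rw [ThresholdAtom.sat_iff]
  by_cases hpos : 0 < (γ.deg : ℚ)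
  · obtain ⟨j, rfl⟩ := List.get_of_mem (List.mem_filter.2 ⟨hγ, decide_eq_true hpos⟩ :
      γ ∈ q.posAtoms)
    have hvalue : ∀ t : Term m q.numEx, t.value J a (fun i => canonicalHom J (ρ i)) =
        canonicalHom J (t.value (canonicalModel T A) a ρ) := by
      intro t
      cases t <;> rfl
    rw [hvalue, hvalue]
    exact (hαle j).trans (canonicalPredicate_le_model hJ.1
      (hJ.2 _ (List.mem_ofFn.2 ⟨j, rfl⟩)) _ _ _)
  · have : (((γ.deg : ℚ)) : ℝ) ≤ 0 := by exact_mod_cast not_lt.1 hpos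
    exact this.trans (J.predicate_nonneg _ _ _)

theorem isCertainAnswer_mono {T : TBox} {A A' : ABox} {q : ThresholdQuery m}
    {a : Fin m → IndName} (hA : ∀ α ∈ A, α ∈ A') (h : q.IsCertainAnswer ⟨T, A⟩ a) :
    q.IsCertainAnswer ⟨T, A'⟩ a :=
  fun Δ J hJ => h Δ J ⟨hJ.1, fun α hα => hJ.2 α (hA α hα)⟩

end FuzzyDL

/-! ### Invariance of certain answers -/

namespace FuzzyDL

/-- A continuous monotone map that raises degrees, fixes those in `D`, and moves no other degree
onto or past one in `D`. -/
structure Inflation (D : Set ℝ) (f : ℝ → ℝ) : Prop where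
  mono : Monotone f
  cont : Continuous f
  le_apply (x : ℝ) : x ≤ f x
  fixed : ∀ d ∈ D, f d = d
  apply_lt : ∀ d ∈ D, ∀ x < d, f x < d

namespace Inflation

variable {D : Set ℝ} {f g : ℝ → ℝ}

protected theorem id (D : Set ℝ) : Inflation D id :=
  ⟨monotone_id, continuous_id, fun _ => le_rfl, fun _ _ => rfl, fun _ _ _ => id⟩

theorem comp (hg : Inflation D g) (hf : Inflation D f) : Inflation D (g ∘ f) where
  mono := hg.mono.comp hf.mono
  cont := hg.cont.comp hf.cont
  le_apply x := (hf.le_apply x).trans (hg.le_apply _)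
  fixed d hd := by rw [Function.comp_apply, hf.fixed d hd, hg.fixed d hd]
  apply_lt d hd x hx := hg.apply_lt d hd _ (hf.apply_lt d hd x hx)

theorem le_apply_iff (hf : Inflation D f) {d : ℝ} (hd : d ∈ D) (x : ℝ) : d ≤ f x ↔ d ≤ x :=
  ⟨fun h => not_lt.1 fun hx => h.not_gt (hf.apply_lt d hd x hx), fun h => h.trans (hf.le_apply x)⟩

theorem mapsTo_Icc (hf : Inflation D f) (h₀ : (0 : ℝ) ∈ D) (h₁ : (1 : ℝ) ∈ D) (x : ℝ)
    (hx : x ∈ Set.Icc (0 : ℝ) 1) : f x ∈ Set.Icc (0 : ℝ) 1 :=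
  ⟨hf.fixed 0 h₀ ▸ hf.mono hx.1, hf.fixed 1 h₁ ▸ hf.mono hx.2⟩

/-- A degree can be raised to any larger one if no degree in `D` is in between. -/
theorem exists_le_apply (hD : D.Finite) {e e' : ℝ} (h : ∀ d ∈ D, e ≤ d → e' < d) :
    ∃ f, Inflation D f ∧ e' ≤ f e := by
  by_cases he : e' ≤ e
  · exact ⟨id, .id D, he⟩
  rw [not_le] at he
  have heD : e ∈ Dᶜ := fun hmem => he.not_gt (h e hmem le_rfl)
  obtain ⟨ε, hε, hball⟩ := Metric.isOpen_iff.1 hD.isClosed.isOpen_compl e heD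
  obtain ⟨p, hp₁, hp₂⟩ := exists_between (sub_lt_self e hε)
  have hD' : ∀ d ∈ D, d ≤ p ∨ e' < d := by
    intro d hd
    by_contra hcon
    push Not at hcon
    by_cases hde : e ≤ d
    · exact hcon.2.not_gt (h d hd hde)
    · refine hball (?_ : d ∈ _) hd
      rw [Metric.mem_ball, Real.dist_eq, abs_lt]
      constructor <;> linarith [hcon.1]
  -- the line through `(p, p)` and `(e, e')`, which has slope at least `1`
  set k := (e' - p) / (e - p) with hk
  have hep : 0 < e - p := sub_pos.2 hp₂
  have hk₁ : 1 ≤ k := by rw [hk, one_le_div hep]; linarith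
  have hline : ∀ x ≤ p, p + (x - p) * k ≤ x := fun x hx => by nlinarith
  refine ⟨fun x => max x (min (p + (x - p) * k) e'), ⟨?_, ?_, ?_, ?_, ?_⟩, ?_⟩
  · intro x y hxy
    have : (x - p) * k ≤ (y - p) * k := by nlinarith
    exact max_le_max hxy (min_le_min_right _ (by linarith))
  · fun_prop
  · exact fun x => le_max_left _ _
  · intro d hd
    rcases hD' d hd with hdp | hde
    · exact max_eq_left (min_le_of_left_le (hline d hdp))
    · exact max_eq_left (min_le_of_right_le hde.le)
  · intro d hd x hx
    rcases hD' d hd with hdp | hde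
    · exact max_lt hx (min_lt_of_left_lt ((hline x (hx.le.trans hdp)).trans_lt hx))
    · exact max_lt hx (min_lt_of_right_lt hde)
  · refine le_max_of_le_right (le_min ?_ le_rfl)
    rw [hk, mul_div_cancel₀ _ hep.ne']
    linarith

theorem exists_le_apply_finite {ι : Type*} [Finite ι] (hD : D.Finite) {e e' : ι → ℝ}
    (h : ∀ i, ∀ d ∈ D, e i ≤ d → e' i < d ∨ e' i ≤ e i) :
    ∃ f, Inflation D f ∧ ∀ i, e' i ≤ f (e i) := by
  classical
  cases nonempty_fintype ι
  have key : ∀ s : Finset ι, ∃ f, Inflation D f ∧ ∀ i ∈ s, e' i ≤ f (e i) := by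
    intro s
    induction s using Finset.induction_on with
    | empty => exact ⟨id, .id D, by simp⟩
    | insert i s _ ih =>
      obtain ⟨f, hf, hfs⟩ := ih
      obtain ⟨g, hg, hgi⟩ : ∃ g, Inflation D g ∧ e' i ≤ g (e i) := by
        by_cases hle : e' i ≤ e i
        · exact ⟨id, .id D, hle⟩
        · exact exists_le_apply hD fun d hd hed => (h i d hd hed).resolve_right hle
      refine ⟨f ∘ g, hf.comp hg, fun j hj => ?_⟩
      rcases Finset.mem_insert.1 hj with rfl | hj
      · exact hgi.trans (hf.le_apply _)
      · exact (hfs j hj).trans (hf.mono (hg.le_apply _))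
  obtain ⟨f, hf, h⟩ := key Finset.univ
  exact ⟨f, hf, fun i => h i (Finset.mem_univ i)⟩

end Inflation

namespace Interpretation

variable {Δ : Type} (I : Interpretation Δ) (σ : IndName → IndName) {f : ℝ → ℝ}

/-- The interpretation with degrees changed by `f` and individual names renamed by `σ`. -/
def transform (hf : ∀ u ∈ Set.Icc (0 : ℝ) 1, f u ∈ Set.Icc (0 : ℝ) 1) : Interpretation Δ where
  ind c := I.ind (σ c)
  concept A x := ⟨f (I.concept A x), hf _ (I.concept A x).2⟩
  role P x y := ⟨f (I.role P x y), hf _ (I.role P x y).2⟩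

variable (hf : ∀ u ∈ Set.Icc (0 : ℝ) 1, f u ∈ Set.Icc (0 : ℝ) 1)

theorem transform_basicRole (Q : BasicRole) (x y : Δ) :
    (I.transform σ hf).basicRole Q x y = f (I.basicRole Q x y) := by
  cases Q <;> rfl

theorem transform_basicConcept (hmono : Monotone f) (hcont : Continuous f) (B : BasicConcept) (x : Δ) :
    (I.transform σ hf).basicConcept B x = f (I.basicConcept B x) := by
  cases B with
  | name A => rfl
  | ex Q =>
    have : Nonempty Δ := ⟨x⟩
    simp only [basicConcept, transform_basicRole]
    exact (hmono.map_ciSup_of_continuousAt hcont.continuousAt (I.bddAbove_basicRole Q x)).symm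

theorem transform_predicate (hmono : Monotone f) (hcont : Continuous f) (π : Predicate) (x y : Δ) :
    (I.transform σ hf).predicate π x y = f (I.predicate π x y) := by
  rcases π with B | P
  · exact I.transform_basicConcept σ hf hmono hcont B x
  · rfl

end Interpretation

theorem min_apply_le {D : Set ℝ} {f : ℝ → ℝ} (hf : Inflation D f) {d u v : ℝ}
    (h : min u d ≤ v) : min (f u) d ≤ f v := by
  rcases min_le_iff.1 h with h | h
  · exact min_le_of_left_le (hf.mono h)
  · exact min_le_of_right_le (h.trans (hf.le_apply v))

/-- Positive axioms survive because degrees are only raised, negative ones because `0` is fixed. -/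
theorem satAxiom_transform {Δ : Type} {I : Interpretation Δ} {D : Set ℝ} {f : ℝ → ℝ}
    (hf : Inflation D f) (h₀ : (0 : ℝ) ∈ D) (h₁ : (1 : ℝ) ∈ D) (σ : IndName → IndName)
    {β : TBoxAxiom} (hβ : I.SatAxiom β) :
    (I.transform σ (hf.mapsTo_Icc h₀ h₁)).SatAxiom β := by
  have hzero : ∀ u ≤ 0, f u ≤ 0 := fun u hu => (hf.mono hu).trans (hf.fixed 0 h₀).le
  rcases β with ⟨B, B' | B', d⟩ | ⟨Q, Q' | Q', d⟩
  · rw [Interpretation.satAxiom_concept_pos] at hβ ⊢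
    intro x
    rw [I.transform_basicConcept σ _ hf.mono hf.cont, I.transform_basicConcept σ _ hf.mono hf.cont]
    exact min_apply_le hf (hβ x)
  · rw [Interpretation.satAxiom_concept_neg] at hβ ⊢
    intro x
    rw [I.transform_basicConcept σ _ hf.mono hf.cont, I.transform_basicConcept σ _ hf.mono hf.cont]
    exact (hβ x).imp_right (Or.imp (hzero _) (hzero _))
  · rw [Interpretation.satAxiom_role_pos] at hβ ⊢
    intro x y
    rw [I.transform_basicRole, I.transform_basicRole]
    exact min_apply_le hf (hβ x y)
  · rw [Interpretation.satAxiom_role_neg] at hβ ⊢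
    intro x y
    rw [I.transform_basicRole, I.transform_basicRole]
    exact (hβ x y).imp_right (Or.imp (hzero _) (hzero _))

variable {m k : ℕ}

/-- A candidate answer together with a family of `k` assertions. -/
abbrev Instance (k m : ℕ) := (Fin k → Assertion) × (Fin m → IndName)

/-- The places of an instance that hold an individual name: the answers, the two places of each
assertion, and the individuals of a fixed list, which stand for themselves. -/
abbrev Slot (k m : ℕ) (C : List IndName) := Fin m ⊕ (Fin k × Bool) ⊕ Fin C.length

/-- The individual at a place of an instance. -/
def Instance.name (C : List IndName) (x : Instance k m) : Slot k m C → IndName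
  | .inl i => x.2 i
  | .inr (.inl (j, false)) => (x.1 j).fst
  | .inr (.inl (j, true)) => (x.1 j).snd
  | .inr (.inr c) => C.get c

/-- The instance `x` satisfies all that `x₀` says about predicates, about equality of
individuals, and about the comparison of degrees with those in `D`. -/
structure Instance.Refines (D : List Degree) (C : List IndName) (x₀ x : Instance k m) : Prop where
  pred (j : Fin k) : (x.1 j).pred = (x₀.1 j).pred
  deg (j : Fin k) : ∀ d ∈ D,
    (d ≤ (x₀.1 j).deg → d ≤ (x.1 j).deg) ∧ (d < (x₀.1 j).deg → d < (x.1 j).deg)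
  name : ∀ s s' : Slot k m C, x₀.name C s = x₀.name C s' → x.name C s = x.name C s'

def Term.individuals : Term m k → List IndName
  | .ind c => [c]
  | _ => []

/-- The individual names that occur in a query. -/
def ThresholdQuery.individuals (q : ThresholdQuery m) : List IndName :=
  q.atoms.flatMap fun γ => γ.fst.individuals ++ γ.snd.individuals

/-- A model for `x` becomes one for `x₀` by renaming individuals and inflating degrees, and this
changes the truth of no atom of the query, since its thresholds are in `D`. -/
theorem Instance.Refines.isCertainAnswer {T : TBox} {q : ThresholdQuery m} {D : List Degree}
    (h₀ : 0 ∈ D) (h₁ : 1 ∈ D) (hq : ∀ γ ∈ q.atoms, γ.deg ∈ D)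
    {x₀ x : Instance k m} (h : x₀.Refines D q.individuals x)
    (hx₀ : q.IsCertainAnswer ⟨T, List.ofFn x₀.1⟩ x₀.2) :
    q.IsCertainAnswer ⟨T, List.ofFn x.1⟩ x.2 := by
  intro Δ J hJ
  set D' : Set ℝ := (fun d : Degree => ((d : ℚ) : ℝ)) '' {d | d ∈ D} with hD'
  have hfin : D'.Finite := (List.finite_toSet D).image _
  have h₀' : (0 : ℝ) ∈ D' := ⟨0, h₀, by simp⟩
  have h₁' : (1 : ℝ) ∈ D' := ⟨1, h₁, by simp⟩
  obtain ⟨f, hf, hdeg⟩ := Inflation.exists_le_apply_finite hfin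
    (e := fun j => (((x.1 j).deg : ℚ) : ℝ)) (e' := fun j => (((x₀.1 j).deg : ℚ) : ℝ)) (by
      rintro j _ ⟨d, hd, rfl⟩ hed
      rw [or_iff_not_imp_left, not_lt]
      intro hde
      have hed' : (x.1 j).deg ≤ d := by
        simpa using hed
      have hde' : d ≤ (x₀.1 j).deg := by
        simpa using hde
      have hcut := h.deg j d hd
      by_contra hcon
      have hcon' : (x.1 j).deg < (x₀.1 j).deg := by exact_mod_cast not_le.1 hcon
      have heq : d = (x.1 j).deg := le_antisymm (hcut.1 hde') hed'
      exact absurd (hcut.2 (heq ▸ hcon')) (heq ▸ lt_irrefl _))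
  set σ : IndName → IndName := Function.extend (x₀.name q.individuals) (x.name q.individuals) id
  have hσ : ∀ s, σ (x₀.name q.individuals s) = x.name q.individuals s :=
    fun s => Function.FactorsThrough.extend_apply (fun s s' hs => h.name s s' hs) id s
  set J' := J.transform σ (hf.mapsTo_Icc h₀' h₁') with hJ'
  have hmodel : J'.IsModel ⟨T, List.ofFn x₀.1⟩ := by
    refine ⟨fun β hβ => satAxiom_transform hf h₀' h₁' σ (hJ.1 β hβ), fun α hα => ?_⟩
    obtain ⟨j, rfl⟩ := List.mem_ofFn.1 hα
    have hsat := (J.satAssertion_iff _).1 (hJ.2 _ (List.mem_ofFn.2 ⟨j, rfl⟩))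
    rw [J'.satAssertion_iff, J.transform_predicate σ _ hf.mono hf.cont]
    have hfst : J'.ind (x₀.1 j).fst = J.ind (x.1 j).fst :=
      congrArg J.ind (hσ (.inr (.inl (j, false))))
    have hsnd : J'.ind (x₀.1 j).snd = J.ind (x.1 j).snd :=
      congrArg J.ind (hσ (.inr (.inl (j, true))))
    rw [hfst, hsnd, ← h.pred j]
    exact (hdeg j).trans (hf.mono hsat)
  obtain ⟨ρ, hρ⟩ := hx₀ Δ J' hmodel
  refine ⟨ρ, fun γ hγ => ?_⟩
  have hterm : ∀ t : Term m q.numEx, t.individuals ⊆ q.individuals →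
      t.value J' x₀.2 ρ = t.value J x.2 ρ := by
    intro t ht
    cases t with
    | answerVar i => exact congrArg J.ind (hσ (.inl i))
    | exVar j => rfl
    | ind c =>
      obtain ⟨i, hi⟩ := List.get_of_mem (ht (List.mem_singleton.2 rfl) : c ∈ q.individuals)
      have := hσ (.inr (.inr i))
      simp only [Instance.name, hi] at this
      exact congrArg J.ind this
  have hsat := (γ.sat_iff _ _ _).1 (hρ γ hγ)
  rw [J.transform_predicate σ _ hf.mono hf.cont, hf.le_apply_iff ⟨_, hq γ hγ, rfl⟩,
    hterm, hterm] at hsat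
  · exact (γ.sat_iff _ _ _).2 hsat
  · exact fun c hc => List.mem_flatMap.2 ⟨γ, hγ, List.mem_append_right _ hc⟩
  · exact fun c hc => List.mem_flatMap.2 ⟨γ, hγ, List.mem_append_left _ hc⟩

end FuzzyDL

/-! ### The language that decides certain answers -/

namespace FuzzyDL

open AC0

theorem degree_le_iff (d e : Degree) : d ≤ e ↔
    (d : ℚ).num.toNat * (e : ℚ).den ≤ (d : ℚ).den * (e : ℚ).num.toNat := by
  have hd := Int.toNat_of_nonneg (Rat.num_nonneg.2 d.2.1)
  have he := Int.toNat_of_nonneg (Rat.num_nonneg.2 e.2.1)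
  rw [← Subtype.coe_le_coe, Rat.le_iff, ← hd, ← he, mul_comm _ ((d : ℚ).den : ℤ)]
  norm_cast

theorem degree_lt_iff (d e : Degree) : d < e ↔
    (d : ℚ).num.toNat * (e : ℚ).den < (d : ℚ).den * (e : ℚ).num.toNat := by
  rw [← not_le, degree_le_iff, not_le, mul_comm, mul_comm (e : ℚ).num.toNat]

variable {m k : ℕ}

/-- The individual that the word `w` has at a place of an instance whose assertions have the
predicates `π` and are written at the positions `u`. -/
def slotValue (C : List IndName) (π : Fin k → Predicate) (w : List Letter) (u : ℕ → ℕ) :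
    Slot k m C → ℕ
  | .inl i => readNat (w.drop (answerPos w i 0))
  | .inr (.inl (j, false)) => field w 1 (u j)
  | .inr (.inl (j, true)) => field w (π j).lastField (u j)
  | .inr (.inr c) => C.get c

/-- The instance that consists of the answer in the word `w` and the assertions written at the
positions `u` refines `x₀`. -/
def Matches (D : List Degree) (C : List IndName) (x₀ : Instance k m) (w : List Letter)
    (u : ℕ → ℕ) : Prop :=
  (∀ j : Fin k, w[u j]? = some (x₀.1 j).pred.letter ∧ field w 0 (u j) = (x₀.1 j).pred.number) ∧
  (∀ j : Fin k, ∀ d ∈ D,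
    (d ≤ (x₀.1 j).deg → (d : ℚ).num.toNat * field w ((x₀.1 j).pred.lastField + 2) (u j) ≤
      (d : ℚ).den * field w ((x₀.1 j).pred.lastField + 1) (u j)) ∧
    (d < (x₀.1 j).deg → (d : ℚ).num.toNat * field w ((x₀.1 j).pred.lastField + 2) (u j) <
      (d : ℚ).den * field w ((x₀.1 j).pred.lastField + 1) (u j))) ∧
  ∀ s s' : Slot k m C, x₀.name C s = x₀.name C s' →
    slotValue C (fun j => (x₀.1 j).pred) w u s = slotValue C (fun j => (x₀.1 j).pred) w u s'

theorem foNum_slotValue (C : List IndName) (π : Fin k → Predicate) (s : Slot k m C) :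
    FONum Letter fun w u => slotValue C π w u s := by
  rcases s with i | ⟨j, _ | _⟩ | c
  · have h : FOFun Letter fun _ _ => 0 := by simpa using FOFun.const (Γ := Letter) 0
    exact foNum_readNat (foFun_answerPos h i)
  · exact foNum_field (.var j) 1
  · exact foNum_field (.var j) _
  · exact .const _

theorem fo_matches (D : List Degree) (C : List IndName) (x₀ : Instance k m) :
    FO (Matches D C x₀) := by
  refine .and (.forall_finite fun j => ?_) (.and (.forall_finite fun j => .forall_mem D fun d => ?_)
    (.forall_finite fun s => .forall_finite fun s' => ?_))
  · exact (FO.letter (.var j) _).and ((foNum_field (.var j) 0).eq (.const _))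
  · have h₁ := (foNum_field (.var j) ((x₀.1 j).pred.lastField + 2)).const_mul (d : ℚ).num.toNat
    have h₂ := (foNum_field (.var j) ((x₀.1 j).pred.lastField + 1)).const_mul (d : ℚ).den
    exact ((FO.const _).imp (h₁.le h₂)).and ((FO.const _).imp (h₂.lt h₁))
  · exact (FO.const _).imp ((foNum_slotValue C _ s).eq (foNum_slotValue C _ s'))

theorem matches_iff_refines {D : List Degree} {C : List IndName} {x₀ x : Instance k m} {A : ABox}
    {u : ℕ → ℕ} (hu : ∀ j : Fin k, WrittenAt (encodeData (A, x.2)) (u j) (x.1 j)) :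
    Matches D C x₀ (encodeData (A, x.2)) u ↔ x₀.Refines D C x := by
  have hpred : (∀ j : Fin k, (encodeData (A, x.2))[u j]? = some (x₀.1 j).pred.letter ∧
      field (encodeData (A, x.2)) 0 (u j) = (x₀.1 j).pred.number) ↔
      ∀ j, (x.1 j).pred = (x₀.1 j).pred := by
    refine forall_congr' fun j => ?_
    rw [(hu j).letter_eq, (hu j).number_eq, Option.some_inj]
    exact ⟨fun h => Predicate.eq_of_letter_of_number h.1 h.2, fun h => by rw [h]; exact ⟨rfl, rfl⟩⟩
  have hslot : (∀ j, (x.1 j).pred = (x₀.1 j).pred) → ∀ s : Slot k m C,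
      slotValue C (fun j => (x₀.1 j).pred) (encodeData (A, x.2)) u s = x.name C s := by
    rintro h (i | ⟨j, _ | _⟩ | c)
    · exact readNat_answer A x.2 i
    · exact (hu j).fst_eq
    · simp only [slotValue, Instance.name, ← h j, (hu j).snd_eq]
    · rfl
  rw [Matches, hpred]
  constructor
  · rintro ⟨h, hdeg, hname⟩
    refine ⟨h, fun j d hd => ?_, fun s s' hs => ?_⟩
    · rw [degree_le_iff d (x.1 j).deg, degree_lt_iff d (x.1 j).deg, ← (hu j).num_eq,
        ← (hu j).den_eq, h j]
      exact hdeg j d hd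
    · rw [← hslot h, ← hslot h]
      exact hname s s' hs
  · rintro ⟨h, hdeg, hname⟩
    refine ⟨h, fun j d hd => ?_, fun s s' hs => ?_⟩
    · have := hdeg j d hd
      rwa [degree_le_iff d (x.1 j).deg, degree_lt_iff d (x.1 j).deg, ← (hu j).num_eq,
        ← (hu j).den_eq, h j] at this
    · rw [hslot h, hslot h]
      exact hname s s' hs

/-- The instances all of whose predicates have names below `M`. -/
abbrev RelevantInstance (M k m : ℕ) := {x : Instance k m // ∀ j, (x.1 j).pred.number < M}

/-- The finite information about an instance that determines whether it refines another one. -/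
def RelevantInstance.type {M : ℕ} (D : List Degree) (C : List IndName)
    (x : RelevantInstance M k m) :
    (Fin k → {π : Predicate // π.number < M}) × (Fin k → Fin D.length → Prop × Prop) ×
      (Slot k m C → Slot k m C → Prop) :=
  (fun j => ⟨(x.1.1 j).pred, x.2 j⟩,
    fun j i => (D.get i ≤ (x.1.1 j).deg, D.get i < (x.1.1 j).deg),
    fun s s' => x.1.name C s = x.1.name C s')

theorem refines_of_type_eq {M : ℕ} {D : List Degree} {C : List IndName}
    {x₀ x : RelevantInstance M k m} (h : x₀.type D C = x.type D C) : x₀.1.Refines D C x.1 where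
  pred j := (congrArg Subtype.val (congrFun (congrArg Prod.fst h) j)).symm
  deg j d hd := by
    obtain ⟨i, rfl⟩ := List.get_of_mem hd
    have h' := congrFun (congrFun (congrArg (fun p => p.2.1) h) j) i
    exact ⟨(congrArg Prod.fst h').mp, (congrArg Prod.snd h').mp⟩
  name s s' := (congrFun (congrFun (congrArg (fun p => p.2.2) h) s) s').mp

/-- The degrees with which those of an ABox have to be compared. Those of the TBox are not among
them, since raising degrees preserves its axioms. -/
def ThresholdQuery.degrees (q : ThresholdQuery m) : List Degree :=
  0 :: 1 :: q.atoms.map ThresholdAtom.deg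

/-- For a word that encodes `(A, a)`, a match of an instance for which the query has a certain
answer makes `a` a certain answer. -/
theorem isCertainAnswer_of_matches {T : TBox} {q : ThresholdQuery m} {A : ABox}
    {a : Fin m → IndName} {x₀ : Instance k m}
    (hx₀ : q.IsCertainAnswer ⟨T, List.ofFn x₀.1⟩ x₀.2) {u : ℕ → ℕ}
    (h : Matches q.degrees q.individuals x₀ (encodeData (A, a)) u) :
    q.IsCertainAnswer ⟨T, A⟩ a := by
  have hw := fun j => exists_writtenAt_of_letter (h.1 j).1
  choose α hαA hα using hw
  have href := (matches_iff_refines (x := (α, a)) hα).1 h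
  have hcert := href.isCertainAnswer (T := T) List.mem_cons_self
    (List.mem_cons_of_mem _ List.mem_cons_self) (fun γ hγ => List.mem_cons_of_mem _
      (List.mem_cons_of_mem _ (List.mem_map_of_mem hγ))) hx₀
  refine isCertainAnswer_mono (fun β hβ => ?_) hcert
  obtain ⟨j, rfl⟩ := List.mem_ofFn.1 hβ
  exact hαA j

theorem exists_number_lt (T : TBox) (q : ThresholdQuery m) :
    ∃ M, (∀ β ∈ T, β.lhsNumber < M) ∧ ∀ γ ∈ q.atoms, γ.pred.number < M := by
  obtain ⟨M, hM⟩ := (List.finite_toSet (T.map TBoxAxiom.lhsNumber ++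
    q.atoms.map fun γ => γ.pred.number)).bddAbove
  refine ⟨M + 1, fun β hβ => Nat.lt_succ_of_le (hM ?_), fun γ hγ => Nat.lt_succ_of_le (hM ?_)⟩
  · exact List.mem_append_left _ (List.mem_map_of_mem hβ)
  · exact List.mem_append_right _ (List.mem_map_of_mem (f := fun γ => γ.pred.number) hγ)

end FuzzyDL

/-- For every fixed TBox `T` and threshold query `q`, deciding whether a tuple `a` of individuals is
a certain answer to `q` over a consistent ontology `(T, A)` is in AC⁰ in the size of `A` and `a`. -/
theorem mainTheorem2 (T : FuzzyDL.TBox) (m : ℕ) (q : FuzzyDL.ThresholdQuery m) :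
    AC0.PromiseInAC0 (ι := FuzzyDL.ABox × (Fin m → FuzzyDL.IndName)) (Γ := FuzzyDL.Letter)
      FuzzyDL.encodeData
      (fun x => (FuzzyDL.Ontology.mk T x.1).Consistent)
      (fun x => q.IsCertainAnswer (FuzzyDL.Ontology.mk T x.1) x.2) := by
  obtain ⟨M, hT, hq⟩ := FuzzyDL.exists_number_lt T q
  -- the types of instances that support a certain answer, each with a representative
  let Pattern := {t // ∃ x₀ : FuzzyDL.RelevantInstance M q.posAtoms.length m,
    x₀.type q.degrees q.individuals = t ∧ q.IsCertainAnswer ⟨T, List.ofFn x₀.1.1⟩ x₀.1.2}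
  let rep : Pattern → FuzzyDL.RelevantInstance M q.posAtoms.length m := fun t => t.2.choose
  have hrep : ∀ t : Pattern, (rep t).type q.degrees q.individuals = t.1 ∧
      q.IsCertainAnswer ⟨T, List.ofFn (rep t).1.1⟩ (rep t).1.2 := fun t => t.2.choose_spec
  have hFO : AC0.FO fun w (_ : ℕ → ℕ) => ∃ t : Pattern, ∃ u, AC0.Bounded w u ∧
      FuzzyDL.Matches q.degrees q.individuals (rep t).1 w u :=
    .exists_finite fun t => .exists_env (FuzzyDL.fo_matches _ _ _)
  refine ⟨_, hFO.inAC0, ?_⟩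
  rintro ⟨A, a⟩ hcons
  constructor
  · rintro ⟨t, u, -, h⟩
    exact FuzzyDL.isCertainAnswer_of_matches (hrep t).2 h
  · intro h
    obtain ⟨α, hα, hcert⟩ := FuzzyDL.exists_support hT hq hcons h
    let x : FuzzyDL.RelevantInstance M q.posAtoms.length m := ⟨(α, a), fun j => (hα j).2⟩
    choose p hp hp' using fun j =>
      FuzzyDL.exists_writtenAt_of_mem (a := a) (hα j).1
    let u : ℕ → ℕ := fun i => if h : i < q.posAtoms.length then p ⟨i, h⟩ else 0
    have hu : ∀ j : Fin q.posAtoms.length, u j = p j := fun j => dif_pos j.2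
    refine ⟨⟨_, x, rfl, hcert⟩, u, fun i => ?_, ?_⟩
    · simp only [u]
      split_ifs
      exacts [hp _, Nat.zero_le _]
    · refine (FuzzyDL.matches_iff_refines (x := (α, a)) fun j => ?_).2
        (FuzzyDL.refines_of_type_eq (x := x) (hrep _).1)
      rw [hu j]
      exact hp' j
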